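/- **Setup.** Let $Y = XB^* + E$ with $B^*\in\mathbb R^{p\times m}$, where the rows of $X\in\mathbb R^{n\times p}$ are i.i.d. $\mathcal N(0,\Sigma)$ with $\Sigma$ positive definite, and the noise $E\in\mathbb R^{n\times m}$ is independent of $X$, has square-integrable entries and satisfies $\mathbb E[EE^T]=m\sigma^2 I$. The rows are split into $K$ folds of equal size $d$ (so $n=dK$); $A^{k}$ denotes the rows of $A$ in the $k$-th fold and $A^{-k}$ the remaining rows. For $B\in\mathbb R^{p\times m}$ with rank $r$ and row support $\mathcal J$, $J=|\mathcal J|$, an *s-pattern* of $B$ is a matrix $SU$, where $S=I[\,,\mathcal J]$ consists of the columns of the $p\times p$ identity indexed by $\mathcal J$, and $U\in\mathbb R^{J\times r}$ has orthonormal columns spanning the column space of $B[\mathcal J,\,]$ if $r<\min(J,m)$, while $U=I_J$ otherwise. Let $SU$ be a given (non-random) s-pattern, $\bar r=\operatorname{rank}(SU)$, $X_{SU}=XSU$, $X^{-k}_{SU}=X^{-k}SU$, and let $S^*U^*$ be an s-pattern of $B^*$. Put $\hat B=SU(X_{SU}^TX_{SU})^{-1}X_{SU}^TY$, $\hat B^{-k}=SU((X^{-k}_{SU})^TX^{-k}_{SU})^{-1}(X^{-k}_{SU})^TY^{-k}$,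 $$\text{Trn-Err}=\|Y-X\hat B\|_F^2,\qquad \text{CV-Err}=\sum_{k=1}^K\|Y^k-X^k\hat B^{-k}\|_F^2 .$$ Let $\mathcal P^\circ$ be the orthogonal projection onto the orthogonal complement of $\operatorname{col}(S^*U^*)\cap\operatorname{col}(SU)$ in $\operatorname{col}(S^*U^*)$. For a fold $k$, let $$B_{SU}=((X^{-k}_{SU})^TX^{-k}_{SU})^{-1}(X^{-k}_{SU})^TX^{-k}\mathcal P^\circ B^*,\quad \bar B_{SU}=(X_{SU}^TX_{SU})^{-1}X_{SU}^TX\mathcal P^\circ B^*,\quad \Sigma_{SU}=(SU)^T(n\Sigma)SU,$$ $$U_0=\mathbb E\big[\|X_{SU}(\bar B_{SU}-\mathbb E B_{SU})\|_F^2\big]+\mathbb E\big[\|\Sigma_{SU}^{1/2}(B_{SU}-\mathbb E B_{SU})\|_F^2\big].$$ **Statement.** Suppose $n-d>\bar r+1$. Then, for every choice of $k$, all the expectations above exist and are finite, and $$\mathbb E[\text{CV-Err}]=\mathbb E\left[\text{Trn-Err}+\frac{(2-(\bar r+1)/n)K-1}{(1-(\bar r+1)/n)K-1}\,m\bar r\sigma^2\right]+U_0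 .$$ In particular, let $m=1$, $y=X\beta^*+\varepsilon$, let $\mathcal J^*$ be the support of $\beta^*$, and let $\mathcal J$ be any given support with $J=|\mathcal J|$ and $n-d>J+1$. For the pattern $I[\,,\mathcal J]$, and every choice of $k$, all expectations exist and are finite, and $$\mathbb E[\text{CV-Err}]=\mathbb E[\text{Trn-Err}]+\frac{(2-(J+1)/n)K-1}{(1-(J+1)/n)K-1}J\sigma^2+\mathbb E\big[\|X_{\mathcal J}(\bar\beta-\mathbb E\beta)\|_2^2\big]+\mathbb E\big[\|\Sigma_{\mathcal J}^{1/2}(\beta-\mathbb E\beta)\|_2^2\big],$$ where $X_{\mathcal I}=X[\,,\mathcal I]$ denotes the columns of $X$ indexed by $\mathcal I$, $\Sigma_{\mathcal J}=n\Sigma[\mathcal J,\mathcal J]$, and, with $\mathcal M=\mathcal J^*\cap\mathcal J^c$, $\bar\beta=(X_{\mathcal J}^TX_{\mathcal J})^{-1}X_{\mathcal J}^TX_{\mathcal M}\beta^*_{\mathcal M}$ and $\beta=((X^{-k}_{\mathcal J})^TX^{-k}_{\mathcal J})^{-1}(X^{-k}_{\mathcal J})^TX^{-k}_{\mathcal M}\beta^*_{\mathcal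 M}$. -/

import Mathlib

open Matrix MeasureTheory ProbabilityTheory
open scoped MatrixOrder

namespace SCV

noncomputable section

/-- Squared Frobenius norm of a real matrix. -/
def frobSq {α β : Type*} [Fintype α] [Fintype β] (A : Matrix α β ℝ) : ℝ :=
  ∑ i, ∑ j, A i j ^ 2

/-- Squared Euclidean norm of a real vector. -/
def sqNorm {α : Type*} [Fintype α] (v : α → ℝ) : ℝ :=
  ∑ i, v i ^ 2

/-! ### Structural patterns -/

/-- The row support of `B`: the indices of its nonzero rows. -/
def rowSupport {p m : ℕ} (B : Matrix (Fin p) (Fin m) ℝ) : Finset (Fin p) :=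
  open Classical in Finset.univ.filter fun j => B j ≠ 0

/-- The columns of `A` indexed by `𝒥`. -/
def colsOf {ν τ : Type*} (A : Matrix ν τ ℝ) (𝒥 : Finset τ) : Matrix ν 𝒥 ℝ :=
  A.submatrix id Subtype.val

/-- The rows of `A` indexed by `𝒥`. -/
def rowsOf {ν τ : Type*} (A : Matrix ν τ ℝ) (𝒥 : Finset ν) : Matrix 𝒥 τ ℝ :=
  A.submatrix Subtype.val id

/-- The selection matrix formed by the columns of the `p × p` identity indexed by `𝒥`. -/
def selection {p : ℕ} (𝒥 : Finset (Fin p)) : Matrix (Fin p) 𝒥 ℝ :=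
  colsOf 1 𝒥

/-- `O` is a structural (selection-projection) pattern `S U` of `B`. Here `S` selects the row
support of `B`. If the rank of `B` is smaller than both the number of nonzero rows and the number
of columns, then `U` is any matrix with orthonormal columns whose column space is that of
the nonzero rows of `B`; otherwise `U` is the identity. The columns of `O` are labelled by a finite
type `ι`, in the second case through a bijection of `ι` with the row support. -/
inductive IsPattern {p m : ℕ} (B : Matrix (Fin p) (Fin m) ℝ)
    {ι : Type*} [Fintype ι] [DecidableEq ι] (O : Matrix (Fin p) ι ℝ) : Prop
  | projection (hr : B.rank < min (rowSupport B).card m)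
      (U : Matrix (rowSupport B) ι ℝ) (horth : Uᵀ * U = 1)
      (hspan : LinearMap.range U.mulVecLin =
        LinearMap.range (rowsOf B (rowSupport B)).mulVecLin)
      (hO : O = selection (rowSupport B) * U) : IsPattern B O
  | selection (hr : ¬ B.rank < min (rowSupport B).card m)
      (e : ι ≃ rowSupport B)
      (hO : O = (selection (rowSupport B)).submatrix id e) : IsPattern B O

/-- The column space of `O`, as a subspace of Euclidean space. -/
def colSpace {p : ℕ} {ι : Type*} [Fintype ι] [DecidableEq ι] (O : Matrix (Fin p) ι ℝ) :
    Submodule ℝ (EuclideanSpace ℝ (Fin p)) :=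
  LinearMap.range (Matrix.toEuclideanLin O)

/-- The matrix of the orthogonal projection onto a subspace. -/
def projMatrix {p : ℕ} (W : Submodule ℝ (EuclideanSpace ℝ (Fin p))) :
    Matrix (Fin p) (Fin p) ℝ :=
  (Matrix.toEuclideanCLM (n := Fin p) (𝕜 := ℝ)).symm W.starProjection

/-- The orthogonal projection onto the orthogonal complement, inside the column space of `Ostar`,
of the intersection of the column spaces of `Ostar` and `O`. -/
def projCirc {p : ℕ} {ι κ : Type*} [Fintype ι] [DecidableEq ι] [Fintype κ] [DecidableEq κ]
    (O : Matrix (Fin p) ι ℝ) (Ostar : Matrix (Fin p) κ ℝ) : Matrix (Fin p) (Fin p) ℝ :=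
  projMatrix (colSpace Ostar ⊓ (colSpace Ostar ⊓ colSpace O)ᗮ)

/-! ### Restricted least squares, training error and cross-validation error -/

/-- Ordinary least squares coefficients `(Zᵀ Z)⁻¹ Zᵀ Y`. -/
def ols {ν ι τ : Type*} [Fintype ν] [Fintype ι] [DecidableEq ι]
    (Z : Matrix ν ι ℝ) (Y : Matrix ν τ ℝ) : Matrix ι τ ℝ :=
  (Zᵀ * Z)⁻¹ * Zᵀ * Y

/-- Ordinary least squares coefficients of a single response vector. -/
def olsVec {ν ι : Type*} [Fintype ν] [Fintype ι] [DecidableEq ι]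
    (Z : Matrix ν ι ℝ) (y : ν → ℝ) : ι → ℝ :=
  ((Zᵀ * Z)⁻¹ * Zᵀ) *ᵥ y

/-- The restricted OLS estimate `O ((X O)ᵀ (X O))⁻¹ (X O)ᵀ Y` for the pattern `O`. -/
def restrictedOLS {ν τ ι : Type*} {p : ℕ} [Fintype ν] [Fintype ι] [DecidableEq ι]
    (X : Matrix ν (Fin p) ℝ) (Y : Matrix ν τ ℝ) (O : Matrix (Fin p) ι ℝ) :
    Matrix (Fin p) τ ℝ :=
  O * ols (X * O) Y

/-- The rows of `A` in the `k`-th fold. -/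
def testPart {n K : ℕ} {τ : Type*} (fold : Fin n → Fin K) (k : Fin K) (A : Matrix (Fin n) τ ℝ) :
    Matrix {i // fold i = k} τ ℝ :=
  A.submatrix Subtype.val id

/-- The rows of `A` outside the `k`-th fold. -/
def trainPart {n K : ℕ} {τ : Type*} (fold : Fin n → Fin K) (k : Fin K) (A : Matrix (Fin n) τ ℝ) :
    Matrix {i // fold i ≠ k} τ ℝ :=
  A.submatrix Subtype.val id

/-- Training error of the pattern `O`. -/
def trnErr {n p : ℕ} {τ ι : Type*} [Fintype τ] [Fintype ι] [DecidableEq ι]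
    (X : Matrix (Fin n) (Fin p) ℝ) (Y : Matrix (Fin n) τ ℝ) (O : Matrix (Fin p) ι ℝ) : ℝ :=
  frobSq (Y - X * restrictedOLS X Y O)

/-- Structural cross-validation error of the pattern `O`. -/
def cvErr {n p K : ℕ} {τ ι : Type*} [Fintype τ] [Fintype ι] [DecidableEq ι]
    (fold : Fin n → Fin K)
    (X : Matrix (Fin n) (Fin p) ℝ) (Y : Matrix (Fin n) τ ℝ) (O : Matrix (Fin p) ι ℝ) : ℝ :=
  ∑ k, frobSq (testPart fold k Y -
    testPart fold k X * restrictedOLS (trainPart fold k X) (trainPart fold k Y) O)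

/-! ### The random design model -/

/-- The random matrices `X` (design) and `E` (noise): the rows of `X` are i.i.d. `N(0, Sigma)`,
`X` and `E` are independent, the entries of `E` are square integrable, and
`𝔼[E Eᵀ] = m σ² I`. -/
structure GaussianModel {Ω : Type*} [MeasurableSpace Ω] (μ : Measure Ω) {n p m : ℕ}
    (Sigma : Matrix (Fin p) (Fin p) ℝ) (σ : ℝ)
    (X : Ω → Matrix (Fin n) (Fin p) ℝ) (E : Ω → Matrix (Fin n) (Fin m) ℝ) : Prop where
  row_law : ∀ i, HasLaw (fun ω => (WithLp.toLp 2 (X ω i) : EuclideanSpace ℝ (Fin p)))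
    (multivariateGaussian 0 Sigma) μ
  row_indep : iIndepFun (fun (i : Fin n) (ω : Ω) => (X ω i : Fin p → ℝ)) μ
  indep : IndepFun (fun ω => (fun i j => X ω i j : Fin n → Fin p → ℝ))
    (fun ω => (fun i j => E ω i j : Fin n → Fin m → ℝ)) μ
  noise_memLp : ∀ i j, MemLp (fun ω => E ω i j) 2 μ
  noise_second_moment : ∀ i j, ∫ ω, (E ω * (E ω)ᵀ) i j ∂μ =
    ((m * σ ^ 2) • (1 : Matrix (Fin n) (Fin n) ℝ)) i j

/-- Entrywise expectation of a random matrix. -/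
def expect {Ω : Type*} [MeasurableSpace Ω] (μ : Measure Ω) {α β : Type*}
    (A : Ω → Matrix α β ℝ) : Matrix α β ℝ :=
  Matrix.of fun i j => ∫ ω, A ω i j ∂μ

/-! ### The term caused by underfitting -/

section Underfit

variable {Ω : Type*} {n p m K : ℕ} {ι κ : Type*}
  [Fintype ι] [DecidableEq ι] [Fintype κ] [DecidableEq κ]

/-- Regression coefficients, on the data without the `k`-th fold, of `X P° B*` on `X O`. -/
def coefTrain (fold : Fin n → Fin K) (k : Fin K) (Bstar : Matrix (Fin p) (Fin m) ℝ)
    (O : Matrix (Fin p) ι ℝ) (Ostar : Matrix (Fin p) κ ℝ) (X : Matrix (Fin n) (Fin p) ℝ) :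
    Matrix ι (Fin m) ℝ :=
  ols (trainPart fold k X * O) (trainPart fold k X * projCirc O Ostar * Bstar)

/-- Regression coefficients, on the whole data, of `X P° B*` on `X O`. -/
def coefFull (Bstar : Matrix (Fin p) (Fin m) ℝ)
    (O : Matrix (Fin p) ι ℝ) (Ostar : Matrix (Fin p) κ ℝ) (X : Matrix (Fin n) (Fin p) ℝ) :
    Matrix ι (Fin m) ℝ :=
  ols (X * O) (X * projCirc O Ostar * Bstar)

/-- The random variable whose expectation is the first summand of `U`. -/
def underfitFull [MeasurableSpace Ω] (μ : Measure Ω) (X : Ω → Matrix (Fin n) (Fin p) ℝ)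
    (fold : Fin n → Fin K) (k : Fin K) (Bstar : Matrix (Fin p) (Fin m) ℝ)
    (O : Matrix (Fin p) ι ℝ) (Ostar : Matrix (Fin p) κ ℝ) (ω : Ω) : ℝ :=
  frobSq (X ω * O * (coefFull Bstar O Ostar (X ω) -
    expect μ fun ω' => coefTrain fold k Bstar O Ostar (X ω')))

/-- The random variable whose expectation is the second summand of `U`. -/
def underfitTrain [MeasurableSpace Ω] (μ : Measure Ω) (Sigma : Matrix (Fin p) (Fin p) ℝ)
    (X : Ω → Matrix (Fin n) (Fin p) ℝ)
    (fold : Fin n → Fin K) (k : Fin K) (Bstar : Matrix (Fin p) (Fin m) ℝ)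
    (O : Matrix (Fin p) ι ℝ) (Ostar : Matrix (Fin p) κ ℝ) (ω : Ω) : ℝ :=
  frobSq (CFC.sqrt (Oᵀ * ((n : ℝ) • Sigma) * O) * (coefTrain fold k Bstar O Ostar (X ω) -
    expect μ fun ω' => coefTrain fold k Bstar O Ostar (X ω')))

/-- `U`, computed with the `k`-th fold. -/
def underfit [MeasurableSpace Ω] (μ : Measure Ω) (Sigma : Matrix (Fin p) (Fin p) ℝ)
    (X : Ω → Matrix (Fin n) (Fin p) ℝ)
    (fold : Fin n → Fin K) (k : Fin K) (Bstar : Matrix (Fin p) (Fin m) ℝ)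
    (O : Matrix (Fin p) ι ℝ) (Ostar : Matrix (Fin p) κ ℝ) : ℝ :=
  ∫ ω, underfitFull μ X fold k Bstar O Ostar ω ∂μ +
    ∫ ω, underfitTrain μ Sigma X fold k Bstar O Ostar ω ∂μ

end Underfit

/-! ### Ordinary variable selection -/

section Selection

variable {n p K : ℕ}

/-- The support of a coefficient vector. -/
def supp (β : Fin p → ℝ) : Finset (Fin p) :=
  open Classical in Finset.univ.filter fun j => β j ≠ 0

/-- The part `X[, 𝒥* ∩ 𝒥ᶜ] β*[𝒥* ∩ 𝒥ᶜ]` of the signal missed by `𝒥`, where `𝒥*` is the support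
of `β*`. -/
def missed {ν : Type*} (X : Matrix ν (Fin p) ℝ) (βstar : Fin p → ℝ) (𝒥 : Finset (Fin p)) : ν → ℝ :=
  colsOf X (supp βstar ∩ 𝒥ᶜ) *ᵥ fun j => βstar j

/-- Coefficients of the missed signal on `X[, 𝒥]` without the `k`-th fold. -/
def betaTrain (fold : Fin n → Fin K) (k : Fin K) (βstar : Fin p → ℝ) (𝒥 : Finset (Fin p))
    (X : Matrix (Fin n) (Fin p) ℝ) : 𝒥 → ℝ :=
  olsVec (colsOf (trainPart fold k X) 𝒥) (missed (trainPart fold k X) βstar 𝒥)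

/-- Coefficients of the missed signal on `X[, 𝒥]` on the whole data. -/
def betaFull (βstar : Fin p → ℝ) (𝒥 : Finset (Fin p))
    (X : Matrix (Fin n) (Fin p) ℝ) : 𝒥 → ℝ :=
  olsVec (colsOf X 𝒥) (missed X βstar 𝒥)

/-- The random variable `‖X[, 𝒥] (β̄ - 𝔼 β)‖²`. -/
def selUnderfitFull {Ω : Type*} [MeasurableSpace Ω] (μ : Measure Ω)
    (X : Ω → Matrix (Fin n) (Fin p) ℝ) (fold : Fin n → Fin K) (k : Fin K)
    (βstar : Fin p → ℝ) (𝒥 : Finset (Fin p)) (ω : Ω) : ℝ :=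
  sqNorm (colsOf (X ω) 𝒥 *ᵥ
    (betaFull βstar 𝒥 (X ω) - fun j => ∫ ω', betaTrain fold k βstar 𝒥 (X ω') j ∂μ))

/-- The random variable `‖(n Sigma[𝒥, 𝒥])^(1/2) (β - 𝔼 β)‖²`. -/
def selUnderfitTrain {Ω : Type*} [MeasurableSpace Ω] (μ : Measure Ω)
    (Sigma : Matrix (Fin p) (Fin p) ℝ)
    (X : Ω → Matrix (Fin n) (Fin p) ℝ) (fold : Fin n → Fin K) (k : Fin K)
    (βstar : Fin p → ℝ) (𝒥 : Finset (Fin p)) (ω : Ω) : ℝ :=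
  sqNorm (CFC.sqrt ((n : ℝ) • Sigma.submatrix (Subtype.val : 𝒥 → Fin p) Subtype.val) *ᵥ
    (betaTrain fold k βstar 𝒥 (X ω) - fun j => ∫ ω', betaTrain fold k βstar 𝒥 (X ω') j ∂μ))

/-- The single-response data `y = X β* + ε`, as a one-column matrix. -/
def response {ν : Type*} (X : Matrix ν (Fin p) ℝ) (βstar : Fin p → ℝ) (ε : ν → ℝ) :
    Matrix ν (Fin 1) ℝ :=
  Matrix.replicateCol (Fin 1) (X *ᵥ βstar + ε)

end Selection

end

end SCV

namespace SCV

/-! ### Gaussian integration by parts -/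

/-! Let `O` be the pattern, with `r` columns, and split `B* = O C + G`, where least squares on `X O`
reproduces the part `X O C` exactly and `G = P° B*`. Put `S = Oᵀ Σ O`, let `Γ = S⁻¹ Oᵀ Σ G` be the
population regression coefficients of `X G` on `X O`, and let `L = G - O Γ`. Then `Oᵀ Σ L = 0`, so
the jointly Gaussian matrices `X O` and `X L` are independent. With the standardized design `W = X O
S^(-1/2)`, whose entries are independent standard Gaussians, the response is `W S^(1/2) (C + Γ) +
N`, where `N = X L + E` is independent of `W` and `𝔼[N Nᵀ] = (c + m σ²) I` with `c = tr (Lᵀ Σ L)`.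
Underfitting thus acts as additional white noise.

Every error now has the form `𝔼 ‖φ(W) N‖² = (c + m σ²) 𝔼 ‖φ(W)‖²` (`integral_frobSq_mul`). The
training residual comes from a projection of rank `n - r`, giving the factor `n - r`. A held-out
fold gives `d + d r / (n - d - r - 1)`, because its rows are independent of the training rows.
Summing over the folds with `n = d K`, the two errors differ by `(c + m σ²) r (1 + n / (n - d - r -
1))`, and the last bracket is the stated factor (`cv_factor_eq`). The part with `m σ²` is the
explicit penalty. The part with `c` is `U₀`: the mean training coefficients equal `Γ`, and the two
summands of `U₀` are `c r` and `n c r / (n - d - r - 1)`. This is `cv_identity`; variable selection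
is the case where `O` is a selection matrix and `G` is the part of `β*` outside `𝒥`.

The analytic input is `𝔼 tr (Wᵀ W)⁻¹ = r / (ν - r - 1)` for a `ν × r` standard Gaussian matrix
(`inverse_wishart`). Stein's identity is applied to the entries of `W (Wᵀ W + ε)⁻¹`, where the ridge
`ε > 0` keeps everything bounded, and then `ε` tends to `0`. Fatou's lemma first yields almost sure
invertibility and integrability; dominated convergence then yields the value. -/

lemma hasDerivAt_gaussianPDFReal_zero_one (x : ℝ) :
    HasDerivAt (gaussianPDFReal 0 1) (-x * gaussianPDFReal 0 1 x) x := by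
  have h : HasDerivAt (fun y : ℝ => (√(2 * Real.pi * 1))⁻¹ * Real.exp (-(y - 0) ^ 2 / (2 * 1)))
      ((√(2 * Real.pi * 1))⁻¹ * (Real.exp (-(x - 0) ^ 2 / (2 * 1)) *
        (-(2 * (x - 0)) / (2 * 1)))) x := by
    have h1 : HasDerivAt (fun y : ℝ => -(y - 0) ^ 2 / (2 * 1)) (-(2 * (x - 0)) / (2 * 1)) x := by
      have := ((((hasDerivAt_id x).sub_const 0).pow 2).neg).div_const (2 * 1)
      simpa using this
    exact (h1.exp).const_mul _
  have e : gaussianPDFReal 0 1 = fun y : ℝ => (√(2 * Real.pi * 1))⁻¹ *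
      Real.exp (-(y - 0) ^ 2 / (2 * 1)) := by
    ext y; simp [gaussianPDFReal]
  rw [e]
  convert h using 1
  ring

/-- Stein's identity for the standard Gaussian law on the line. -/
lemma stein_gaussianReal {f f' : ℝ → ℝ} {C C' : ℝ} (hf : ∀ x, HasDerivAt f (f' x) x)
    (hb : ∀ x, |f x| ≤ C) (hb' : ∀ x, |f' x| ≤ C') :
    ∫ x, x * f x ∂gaussianReal 0 1 = ∫ x, f' x ∂gaussianReal 0 1 := by
  have hfm : Measurable f :=
    (continuous_iff_continuousAt.2 fun x => (hf x).continuousAt).measurable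
  have hfm' : Measurable f' := by
    have : f' = deriv f := funext fun x => (hf x).deriv.symm
    rw [this]; exact measurable_deriv f
  have hid : Integrable (fun x : ℝ => x * gaussianPDFReal 0 1 x) := by
    have h : Integrable (fun x : ℝ => x) (gaussianReal 0 1) :=
      (IsGaussian.integrable_id (μ := gaussianReal 0 1))
    rw [gaussianReal_of_var_ne_zero _ one_ne_zero,
      integrable_withDensity_iff (measurable_gaussianPDF _ _)
        (ae_of_all _ fun _ => gaussianPDF_lt_top)] at h
    simpa using h
  rw [integral_gaussianReal_eq_integral_smul one_ne_zero,
    integral_gaussianReal_eq_integral_smul one_ne_zero]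
  have hp := integrable_gaussianPDFReal 0 1
  have h := integral_mul_deriv_eq_deriv_mul_of_integrable (u := f) (v := gaussianPDFReal 0 1)
    (u' := f') (v' := fun x => -x * gaussianPDFReal 0 1 x) (fun x _ => hf x)
    (fun x _ => hasDerivAt_gaussianPDFReal_zero_one x)
    (by
      have := (hid.neg).bdd_mul hfm.aestronglyMeasurable (ae_of_all _ hb)
      refine this.congr (ae_of_all _ fun x => ?_)
      simp)
    (hp.bdd_mul hfm'.aestronglyMeasurable (ae_of_all _ hb'))
    (hp.bdd_mul hfm.aestronglyMeasurable (ae_of_all _ hb))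
  calc ∫ x, gaussianPDFReal 0 1 x • (x * f x)
      = - ∫ x, f x * (-x * gaussianPDFReal 0 1 x) := by
        rw [← integral_neg]; congr 1; ext x; simp; ring
    _ = ∫ x, f' x * gaussianPDFReal 0 1 x := by rw [h, neg_neg]
    _ = _ := by congr 1; ext x; simp [mul_comm]

/-- Resampling one coordinate preserves a product measure. -/
lemma measurePreserving_update {T : Type*} [Fintype T] [DecidableEq T] (γ : Measure ℝ)
    [IsProbabilityMeasure γ] (t : T) :
    MeasurePreserving (fun q : (T → ℝ) × ℝ => Function.update q.1 t q.2)
      ((Measure.pi fun _ : T => γ).prod γ) (Measure.pi fun _ : T => γ) where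
  measurable := by
    refine measurable_pi_lambda _ fun s => ?_
    by_cases h : s = t
    · subst h; simpa using measurable_snd
    · simp only [ne_eq, h, not_false_eq_true, Function.update_of_ne]; fun_prop
  map_eq := by
    have hm : Measurable (fun q : (T → ℝ) × ℝ => Function.update q.1 t q.2) := by
      refine measurable_pi_lambda _ fun s => ?_
      by_cases h : s = t
      · subst h; simpa using measurable_snd
      · simp only [ne_eq, h, not_false_eq_true, Function.update_of_ne]; fun_prop
    symm
    refine Measure.pi_eq fun s hs => ?_
    rw [Measure.map_apply hm (MeasurableSet.univ_pi hs)]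
    -- The preimage of a box is again a box: the side at `t` becomes free and its constraint passes
    -- to the new coordinate.
    have : (fun q : (T → ℝ) × ℝ => Function.update q.1 t q.2) ⁻¹' Set.univ.pi s =
        (Set.univ.pi (Function.update s t Set.univ)) ×ˢ s t := by
      ext ⟨x, y⟩
      simp only [Set.mem_preimage, Set.mem_pi, Set.mem_univ, true_imp_iff, Set.mem_prod]
      constructor
      · intro h
        refine ⟨fun u => ?_, by simpa using h t⟩
        by_cases hu : u = t
        · subst hu; simp
        · simpa [hu] using h u
      · rintro ⟨h1, h2⟩ u
        by_cases hu : u = t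
        · subst hu; simpa using h2
        · simpa [hu] using h1 u
    rw [this, Measure.prod_prod, Measure.pi_pi, ← Finset.mul_prod_erase _ _ (Finset.mem_univ t),
      ← Finset.mul_prod_erase (f := fun i => γ (s i)) _ (Finset.mem_univ t)]
    simp only [Function.update_self, measure_univ, one_mul]
    rw [mul_comm]
    congr 1
    refine Finset.prod_congr rfl fun i hi => ?_
    rw [Function.update_of_ne (Finset.ne_of_mem_erase hi)]

/-- Stein's identity for a vector of independent standard Gaussian variables. -/
lemma stein_pi {T : Type*} [Fintype T] [DecidableEq T] (t : T) {F F' : (T → ℝ) → ℝ} {C C' : ℝ}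
    (hF : ∀ x s, HasDerivAt (fun u => F (Function.update x t u)) (F' (Function.update x t s)) s)
    (hFm : Measurable F) (hFm' : Measurable F')
    (hb : ∀ x, |F x| ≤ C) (hb' : ∀ x, |F' x| ≤ C') :
    Integrable (fun x => x t * F x) (Measure.pi fun _ : T => gaussianReal 0 1) ∧
    Integrable F' (Measure.pi fun _ : T => gaussianReal 0 1) ∧
    ∫ x, x t * F x ∂(Measure.pi fun _ : T => gaussianReal 0 1) =
      ∫ x, F' x ∂(Measure.pi fun _ : T => gaussianReal 0 1) := by
  have i1 : Integrable (fun x : T → ℝ => x t) (Measure.pi fun _ : T => gaussianReal 0 1) :=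
    integrable_eval IsGaussian.integrable_id
  have i2 : Integrable (fun x => x t * F x) (Measure.pi fun _ : T => gaussianReal 0 1) :=
    i1.mul_bdd hFm.aestronglyMeasurable (ae_of_all _ hb)
  have i3 : Integrable F' (Measure.pi fun _ : T => gaussianReal 0 1) :=
    Integrable.of_bound hFm'.aestronglyMeasurable C' (ae_of_all _ hb')
  refine ⟨i2, i3, ?_⟩
  have mp := measurePreserving_update (gaussianReal 0 1) t
  -- Resampling coordinate `t` and applying Fubini turns the integral into an average of integrals
  -- along that coordinate, where the one-dimensional identity applies.
  have key : ∀ g : (T → ℝ) → ℝ, Integrable g (Measure.pi fun _ : T => gaussianReal 0 1) →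
      ∫ x, g x ∂(Measure.pi fun _ : T => gaussianReal 0 1) =
      ∫ x, ∫ s, g (Function.update x t s) ∂(gaussianReal 0 1)
        ∂(Measure.pi fun _ : T => gaussianReal 0 1) := by
    intro g hg
    rw [← integral_prod (fun q : (T → ℝ) × ℝ => g (Function.update q.1 t q.2))]
    · conv_lhs => rw [← mp.map_eq]
      rw [integral_map mp.measurable.aemeasurable (by rw [mp.map_eq]; exact hg.1)]
    · exact mp.integrable_comp_of_integrable hg
  rw [key _ i2, key _ i3]
  congr 1
  ext x
  simp only [Function.update_self]
  exact stein_gaussianReal (hF x) (fun s => hb _) (fun s => hb' _)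

/-! ### Entrywise measurability of random matrices -/

section Measurability

variable {Ω α β γ : Type*} [MeasurableSpace Ω]

lemma measurable_mul_apply [Fintype β] {A : Ω → Matrix α β ℝ} {B : Ω → Matrix β γ ℝ}
    (hA : ∀ i j, Measurable fun ω => A ω i j) (hB : ∀ i j, Measurable fun ω => B ω i j) (i : α)
    (j : γ) : Measurable fun ω => (A ω * B ω) i j := by
  simp only [Matrix.mul_apply]
  exact Finset.measurable_sum _ fun l _ => (hA i l).mul (hB l j)

lemma measurable_det [Fintype α] [DecidableEq α] {A : Ω → Matrix α α ℝ}
    (hA : ∀ i j, Measurable fun ω => A ω i j) : Measurable fun ω => (A ω).det := by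
  simp only [Matrix.det_apply]
  exact Finset.measurable_sum _ fun l _ =>
    (Finset.measurable_prod _ fun i _ => hA _ _).const_smul _

lemma measurable_inv_apply [Fintype α] [DecidableEq α] {A : Ω → Matrix α α ℝ}
    (hA : ∀ i j, Measurable fun ω => A ω i j) (i j : α) :
    Measurable fun ω => (A ω)⁻¹ i j := by
  simp only [Matrix.inv_def, Ring.inverse_eq_inv', Matrix.smul_apply, Matrix.adjugate_apply,
    smul_eq_mul]
  refine (measurable_det hA).inv.mul (measurable_det fun a b => ?_)
  simp only [Matrix.updateRow_apply]
  split_ifs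
  · exact measurable_const
  · exact hA _ _

lemma measurable_trace [Fintype α] {A : Ω → Matrix α α ℝ}
    (hA : ∀ i j, Measurable fun ω => A ω i j) : Measurable fun ω => (A ω).trace :=
  Finset.measurable_sum _ fun i _ => hA i i

end Measurability

/-! ### The derivative of the matrix inverse -/

/-- The resolvent identity `A(u)⁻¹ - A(s)⁻¹ = -A(u)⁻¹ (A(u) - A(s)) A(s)⁻¹` turns slopes of the
inverse into slopes of `A`. Continuity of the inverse, read off from adjugate and determinant, gives
the limit. -/
lemma hasDerivAt_matrix_inv {ι : Type*} [Fintype ι] [DecidableEq ι] {A : ℝ → Matrix ι ι ℝ}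
    {A' : Matrix ι ι ℝ} {s : ℝ} (hA : ∀ i j, HasDerivAt (fun u => A u i j) (A' i j) s)
    (hdet : ∀ u, IsUnit (A u).det) (i j : ι) :
    HasDerivAt (fun u => (A u)⁻¹ i j) (-((A s)⁻¹ * A' * (A s)⁻¹) i j) s := by
  have hcA : ContinuousAt A s :=
    continuousAt_pi.2 fun i => continuousAt_pi.2 fun j => (hA i j).continuousAt
  have hcB : ContinuousAt (fun u => (A u)⁻¹) s := by
    have h1 : ContinuousAt (fun u => ((A u).det)⁻¹) s :=
      ((Continuous.matrix_det continuous_id).continuousAt.comp hcA).inv₀ (hdet s).ne_zero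
    have h2 : ContinuousAt (fun u => (A u).adjugate) s :=
      (Continuous.matrix_adjugate continuous_id).continuousAt.comp hcA
    simp only [Matrix.inv_def, Ring.inverse_eq_inv']
    exact h1.smul h2
  rw [hasDerivAt_iff_tendsto_slope]
  have hlim : Filter.Tendsto (fun u => -((A u)⁻¹ * ((u - s)⁻¹ • (A u - A s)) * (A s)⁻¹) i j)
      (nhdsWithin s {s}ᶜ) (nhds (-((A s)⁻¹ * A' * (A s)⁻¹) i j)) := by
    have h1 : Filter.Tendsto (fun u => (A u)⁻¹) (nhdsWithin s {s}ᶜ) (nhds (A s)⁻¹) :=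
      hcB.tendsto.mono_left nhdsWithin_le_nhds
    have h2 : Filter.Tendsto (fun u => (u - s)⁻¹ • (A u - A s)) (nhdsWithin s {s}ᶜ) (nhds A') := by
      refine tendsto_pi_nhds.2 fun i => tendsto_pi_nhds.2 fun j => ?_
      have := hasDerivAt_iff_tendsto_slope.1 (hA i j)
      refine this.congr fun u => ?_
      simp [slope_def_field, div_eq_inv_mul]
    have h3 : Filter.Tendsto (fun u => (A u)⁻¹ * ((u - s)⁻¹ • (A u - A s)) * (A s)⁻¹)
        (nhdsWithin s {s}ᶜ) (nhds ((A s)⁻¹ * A' * (A s)⁻¹)) := (h1.mul h2).mul_const _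
    exact ((tendsto_pi_nhds.1 (tendsto_pi_nhds.1 h3 i)) j).neg
  refine hlim.congr' ?_
  filter_upwards with u
  have e : (A u)⁻¹ - (A s)⁻¹ = -((A u)⁻¹ * (A u - A s) * (A s)⁻¹) := by
    rw [Matrix.mul_sub, Matrix.sub_mul, Matrix.nonsing_inv_mul _ (hdet u), Matrix.mul_assoc,
      Matrix.mul_nonsing_inv _ (hdet s)]
    simp
  rw [slope_def_field, ← Matrix.sub_apply, e]
  simp [div_eq_inv_mul]

/-! ### Regularized Gram matrices -/

section Regularized

variable {ν ι : Type*} [Fintype ν] [Fintype ι] [DecidableEq ι]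

lemma posDef_gram_add (W : Matrix ν ι ℝ) {ε : ℝ} (hε : 0 < ε) :
    (Wᵀ * W + ε • (1 : Matrix ι ι ℝ)).PosDef := by
  have h1 : (Wᵀ * W).PosSemidef := by
    simpa using Matrix.posSemidef_conjTranspose_mul_self W
  exact Matrix.PosDef.posSemidef_add h1 (Matrix.PosDef.one.smul hε)

variable (W : Matrix ν ι ℝ) {ε : ℝ} {B : Matrix ι ι ℝ}

/-- The last identity is `B = B (Wᵀ W + ε) B` with `B` symmetric. It writes `B` as a sum of Gram
matrices, so that its diagonal bounds individual entries. -/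
lemma regularized_self (hε : 0 < ε) (hB : B = (Wᵀ * W + ε • (1 : Matrix ι ι ℝ))⁻¹) :
    Bᵀ = B ∧ Wᵀ * W * B = 1 - ε • B ∧ B = (W * B)ᵀ * (W * B) + ε • (Bᵀ * B) := by
  have hpd := posDef_gram_add W hε
  have hu : IsUnit (Wᵀ * W + ε • (1 : Matrix ι ι ℝ)).det := hpd.det_pos.ne'.isUnit
  have hs : Bᵀ = B := by
    rw [hB, Matrix.transpose_nonsing_inv]
    simp [Matrix.transpose_mul]
  have h1 : (Wᵀ * W + ε • (1 : Matrix ι ι ℝ)) * B = 1 := by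
    rw [hB, Matrix.mul_nonsing_inv _ hu]
  have h2 : Wᵀ * W * B = 1 - ε • B := by
    rw [Matrix.add_mul] at h1
    rw [eq_sub_iff_add_eq]; simpa using h1
  refine ⟨hs, h2, ?_⟩
  rw [Matrix.transpose_mul, hs, Matrix.mul_assoc, ← Matrix.mul_assoc Wᵀ, h2, Matrix.mul_sub]
  simp

/-- The diagonal of `B = (W B)ᵀ (W B) + ε Bᵀ B` is a sum of squares containing `(W B) i j ^ 2` and
`ε B j j ^ 2`. The second of these forces `B j j ≤ ε⁻¹`. These bounds do not depend on `W`, as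
Stein's identity for bounded functions requires. -/
lemma regularized_diag_bounds (hε : 0 < ε) (hB : B = (Wᵀ * W + ε • (1 : Matrix ι ι ℝ))⁻¹) (j : ι) :
    0 ≤ B j j ∧ B j j ≤ ε⁻¹ ∧ ∀ i, (W * B) i j ^ 2 ≤ B j j := by
  obtain ⟨hs, h2, h3⟩ := regularized_self W hε hB
  have hd : B j j = ∑ l, (W * B) l j ^ 2 + ε * ∑ l, B l j ^ 2 := by
    conv_lhs => rw [h3]
    rw [Matrix.add_apply, Matrix.smul_apply, Matrix.mul_apply (M := (W * B)ᵀ),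
      Matrix.mul_apply (M := Bᵀ)]
    simp only [Matrix.transpose_apply, sq, smul_eq_mul]
  have a0 : 0 ≤ ∑ l, (W * B) l j ^ 2 := Finset.sum_nonneg fun _ _ => sq_nonneg _
  have a2 : B j j ^ 2 ≤ ∑ l, B l j ^ 2 :=
    Finset.single_le_sum (f := fun l => B l j ^ 2) (fun _ _ => sq_nonneg _) (Finset.mem_univ j)
  have b1 : ε * B j j ^ 2 ≤ B j j := by
    nlinarith [mul_le_mul_of_nonneg_left a2 hε.le]
  have b0 : 0 ≤ B j j := le_trans (by positivity) b1
  refine ⟨b0, ?_, fun i => ?_⟩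
  · rw [← one_div, le_div_iff₀ hε]
    by_contra! h
    nlinarith
  · have a1 : (W * B) i j ^ 2 ≤ ∑ l, (W * B) l j ^ 2 :=
      Finset.single_le_sum (f := fun l => (W * B) l j ^ 2) (fun _ _ => sq_nonneg _)
        (Finset.mem_univ i)
    have : 0 ≤ ε * ∑ l, B l j ^ 2 := mul_nonneg hε.le (Finset.sum_nonneg fun _ _ => sq_nonneg _)
    linarith

/-- The ridge hat matrix satisfies `H = Hᵀ H + ε (B Wᵀ)ᵀ (B Wᵀ)`, hence `H i i ^ 2 ≤ H i i`. -/
lemma regularized_hat_bounds (hε : 0 < ε) (hB : B = (Wᵀ * W + ε • (1 : Matrix ι ι ℝ))⁻¹) (i : ν) :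
    0 ≤ (W * B * Wᵀ) i i ∧ (W * B * Wᵀ) i i ≤ 1 := by
  obtain ⟨hs, h2, -⟩ := regularized_self W hε hB
  have hH : W * B * Wᵀ = (W * B * Wᵀ)ᵀ * (W * B * Wᵀ) + ε • ((B * Wᵀ)ᵀ * (B * Wᵀ)) := by
    have e1 : (W * B * Wᵀ)ᵀ = W * B * Wᵀ := by
      simp [Matrix.transpose_mul, hs, Matrix.mul_assoc]
    have e2 : (W * B * Wᵀ) * (W * B * Wᵀ) = W * B * (Wᵀ * W * B) * Wᵀ := by
      simp only [Matrix.mul_assoc]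
    rw [e1, e2, h2, Matrix.transpose_mul, hs, Matrix.mul_sub, Matrix.sub_mul]
    simp [Matrix.mul_assoc]
  have hHd : (W * B * Wᵀ) i i = ∑ l, (W * B * Wᵀ) l i ^ 2 + ε * ∑ l, (B * Wᵀ) l i ^ 2 := by
    conv_lhs => rw [hH]
    rw [Matrix.add_apply, Matrix.smul_apply, Matrix.mul_apply (M := (W * B * Wᵀ)ᵀ),
      Matrix.mul_apply (M := (B * Wᵀ)ᵀ)]
    simp only [Matrix.transpose_apply, sq, smul_eq_mul]
  have c1 : (W * B * Wᵀ) i i ^ 2 ≤ ∑ l, (W * B * Wᵀ) l i ^ 2 :=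
    Finset.single_le_sum (f := fun l => (W * B * Wᵀ) l i ^ 2) (fun _ _ => sq_nonneg _)
      (Finset.mem_univ i)
  have c2 : 0 ≤ ε * ∑ l, (B * Wᵀ) l i ^ 2 :=
    mul_nonneg hε.le (Finset.sum_nonneg fun _ _ => sq_nonneg _)
  exact ⟨by nlinarith, by nlinarith⟩

/-- The spectral form of traces of inverse regularized Gram matrices. -/
lemma exists_trace_regularized_eq :
    ∃ l : ι → ℝ, (∀ i, 0 ≤ l i) ∧ (Wᵀ * W).det = ∏ i, l i ∧
      ∀ ε : ℝ, (∀ i, l i + ε ≠ 0) →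
        ((Wᵀ * W + ε • (1 : Matrix ι ι ℝ))⁻¹).trace = ∑ i, (l i + ε)⁻¹ ∧
        ((Wᵀ * W + ε • (1 : Matrix ι ι ℝ))⁻¹ * (Wᵀ * W + ε • (1 : Matrix ι ι ℝ))⁻¹).trace =
          ∑ i, (l i + ε)⁻¹ ^ 2 := by
  have hM : (Wᵀ * W).PosSemidef := by simpa using Matrix.posSemidef_conjTranspose_mul_self W
  set U : Matrix ι ι ℝ := (hM.1.eigenvectorUnitary : Matrix ι ι ℝ) with hU
  have hUU : U * star U = 1 := Unitary.coe_mul_star_self _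
  have hUU' : star U * U = 1 := Unitary.coe_star_mul_self _
  have hsp : Wᵀ * W = U * diagonal hM.1.eigenvalues * star U := by
    have := hM.1.spectral_theorem
    rw [Unitary.conjStarAlgAut_apply] at this
    simpa [Function.comp_def] using this
  refine ⟨hM.1.eigenvalues, hM.eigenvalues_nonneg, by simpa using hM.1.det_eq_prod_eigenvalues,
    fun ε hε => ?_⟩
  have h1 : Wᵀ * W + ε • (1 : Matrix ι ι ℝ) =
      U * diagonal (fun i => hM.1.eigenvalues i + ε) * star U := by
    have : diagonal (fun i => hM.1.eigenvalues i + ε) =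
        diagonal hM.1.eigenvalues + ε • (1 : Matrix ι ι ℝ) := by
      ext a b
      by_cases h : a = b <;> simp [h]
    rw [this, Matrix.mul_add, Matrix.add_mul, ← hsp]
    simp [hUU]
  have h2 : (Wᵀ * W + ε • (1 : Matrix ι ι ℝ))⁻¹ =
      U * diagonal (fun i => (hM.1.eigenvalues i + ε)⁻¹) * star U := by
    refine Matrix.inv_eq_right_inv ?_
    rw [h1]
    calc U * diagonal (fun i => hM.1.eigenvalues i + ε) * star U *
          (U * diagonal (fun i => (hM.1.eigenvalues i + ε)⁻¹) * star U)
        = U * diagonal (fun i => hM.1.eigenvalues i + ε) * (star U *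
          U) * diagonal (fun i => (hM.1.eigenvalues i + ε)⁻¹) * star U := by
          simp only [Matrix.mul_assoc]
      _ = U * (diagonal (fun i => hM.1.eigenvalues i + ε) *
          diagonal (fun i => (hM.1.eigenvalues i + ε)⁻¹)) * star U := by
          rw [hUU']; simp only [Matrix.mul_assoc, Matrix.one_mul]
      _ = 1 := by
          rw [diagonal_mul_diagonal]
          simp [hε, hUU]
  have tr : ∀ D : Matrix ι ι ℝ, (U * D * star U).trace = D.trace := fun D => by
    rw [Matrix.trace_mul_comm, ← Matrix.mul_assoc, hUU', Matrix.one_mul]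
  refine ⟨by rw [h2, tr, trace_diagonal], ?_⟩
  have : U * diagonal (fun i => (hM.1.eigenvalues i + ε)⁻¹) * star U *
      (U * diagonal (fun i => (hM.1.eigenvalues i + ε)⁻¹) * star U) =
      U * (diagonal (fun i => (hM.1.eigenvalues i + ε)⁻¹) *
        diagonal (fun i => (hM.1.eigenvalues i + ε)⁻¹)) * star U := by
    rw [show U * diagonal (fun i => (hM.1.eigenvalues i + ε)⁻¹) * star U *
      (U * diagonal (fun i => (hM.1.eigenvalues i + ε)⁻¹) * star U) =
      U * diagonal (fun i => (hM.1.eigenvalues i + ε)⁻¹) * (star U * U) *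
        diagonal (fun i => (hM.1.eigenvalues i + ε)⁻¹) * star U by simp only [Matrix.mul_assoc],
      hUU']
    simp only [Matrix.mul_assoc, Matrix.one_mul]
  rw [h2, this, tr, diagonal_mul_diagonal, trace_diagonal]
  simp [sq]

end Regularized

/-! ### The expected trace of an inverse Wishart matrix -/

/-- The matrix with entries given by a coordinate vector. -/
abbrev toMat {ν ι : Type*} (x : ν × ι → ℝ) : Matrix ν ι ℝ := Matrix.of fun a b => x (a, b)

lemma measurable_toMat {ν ι : Type*} (i : ν) (j : ι) :
    Measurable fun x : ν × ι → ℝ => toMat x i j :=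
  measurable_pi_apply (i, j)

section Wishart

variable {ν ι : Type*} [Fintype ν] [Fintype ι] [DecidableEq ι]

/-- Moving the entry `(i, j)` moves `W` in the direction of the matrix unit `D`. The product rule
gives `D B - W B (Dᵀ W + Wᵀ D) B`, whose `(i, j)` entry has the three stated terms. -/
lemma hasDerivAt_regularized [DecidableEq ν] {ε : ℝ} (hε : 0 < ε) (i : ν) (j : ι)
    (x : ν × ι → ℝ) (s : ℝ) :
    HasDerivAt (fun u => (Matrix.of (fun a b => Function.update x (i, j) u (a, b)) *
        ((Matrix.of fun a b => Function.update x (i, j) u (a, b))ᵀ *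
          (Matrix.of fun a b => Function.update x (i, j) u (a, b)) +
          ε • (1 : Matrix ι ι ℝ))⁻¹) i j)
      ((fun W : Matrix ν ι ℝ => (fun B : Matrix ι ι ℝ =>
        B j j - (W * B) i j ^ 2 - (W * B * Wᵀ) i i * B j j)
          (Wᵀ * W + ε • (1 : Matrix ι ι ℝ))⁻¹)
        (Matrix.of fun a b => Function.update x (i, j) s (a, b))) s := by
  set W : ℝ → Matrix ν ι ℝ := fun u => Matrix.of fun a b => Function.update x (i, j) u (a, b)
    with hW
  set D : Matrix ν ι ℝ := Matrix.single i j 1 with hD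
  have hWd : ∀ a b, HasDerivAt (fun u => W u a b) (D a b) s := by
    intro a b
    by_cases h : (a, b) = (i, j)
    · obtain ⟨rfl, rfl⟩ := Prod.mk.inj h
      simpa [hW, hD] using hasDerivAt_id' s
    · have h' : ¬ (i = a ∧ j = b) := fun ⟨h1, h2⟩ => h (by rw [h1, h2])
      simpa [hW, hD, Function.update_of_ne h, Matrix.single, h'] using hasDerivAt_const s (x (a, b))
  set A : ℝ → Matrix ι ι ℝ := fun u => (W u)ᵀ * W u + ε • (1 : Matrix ι ι ℝ) with hA
  have hAd : ∀ a b, HasDerivAt (fun u => A u a b) ((Dᵀ * W s + (W s)ᵀ * D) a b) s := by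
    intro a b
    have h1 : HasDerivAt (fun u => ∑ c, W u c a * W u c b)
        (∑ c, (D c a * W s c b + W s c a * D c b)) s :=
      HasDerivAt.fun_sum fun c _ => (hWd c a).mul (hWd c b)
    have h2 := h1.add_const ((ε • (1 : Matrix ι ι ℝ)) a b)
    simpa [hA, Matrix.mul_apply, Finset.sum_add_distrib] using h2
  have hu : ∀ u, IsUnit (A u).det := fun u => (posDef_gram_add (W u) hε).det_pos.ne'.isUnit
  have hBd := hasDerivAt_matrix_inv hAd hu
  have h1 : HasDerivAt (fun u => ∑ c, W u i c * (A u)⁻¹ c j)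
      (∑ c, (D i c * (A s)⁻¹ c j +
        W s i c * (-((A s)⁻¹ * (Dᵀ * W s + (W s)ᵀ * D) * (A s)⁻¹) c j))) s :=
    HasDerivAt.fun_sum fun c _ => (hWd i c).mul (hBd c j)
  have hs : ((A s)⁻¹)ᵀ = (A s)⁻¹ := (regularized_self (W s) hε rfl).1
  have e : (∑ c, (D i c * (A s)⁻¹ c j +
        W s i c * (-((A s)⁻¹ * (Dᵀ * W s + (W s)ᵀ * D) * (A s)⁻¹) c j))) =
      (A s)⁻¹ j j - (W s * (A s)⁻¹) i j ^ 2 - (W s * (A s)⁻¹ * (W s)ᵀ) i i * (A s)⁻¹ j j := by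
    have e1 : ∑ c, (D i c * (A s)⁻¹ c j +
        W s i c * (-((A s)⁻¹ * (Dᵀ * W s + (W s)ᵀ * D) * (A s)⁻¹) c j)) =
        (D * (A s)⁻¹) i j - (W s * (A s)⁻¹ * Dᵀ * (W s * (A s)⁻¹)) i j -
          (W s * (A s)⁻¹ * (W s)ᵀ * (D * (A s)⁻¹)) i j := by
      have : (D * (A s)⁻¹) i j - (W s * (A s)⁻¹ * Dᵀ * (W s * (A s)⁻¹)) i j -
          (W s * (A s)⁻¹ * (W s)ᵀ * (D * (A s)⁻¹)) i j =
          (D * (A s)⁻¹ - W s * ((A s)⁻¹ * (Dᵀ * W s + (W s)ᵀ * D) * (A s)⁻¹)) i j := by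
        simp only [Matrix.sub_apply, Matrix.mul_add, Matrix.add_mul, Matrix.add_apply,
          Matrix.mul_assoc]
        ring
      rw [this, Matrix.sub_apply, Matrix.mul_apply, Matrix.mul_apply (M := W s)]
      simp only [mul_neg, ← sub_eq_add_neg, Finset.sum_sub_distrib]
    rw [e1]
    congr 1
    · congr 1
      · simp [hD]
      · rw [Matrix.mul_assoc, hD, Matrix.transpose_single, sq]
        rw [Matrix.mul_apply (M := W s * (A s)⁻¹)
          (N := Matrix.single j i 1 * (W s * (A s)⁻¹)), Finset.sum_eq_single j]
        · simp
        · intro c _ hc; simp [hc]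
        · simp
    · rw [hD, Matrix.mul_apply, Finset.sum_eq_single i]
      · simp
      · intro c _ hc; simp [hc]
      · simp
  rw [e] at h1
  have hfun : (fun u => ∑ c, W u i c * (A u)⁻¹ c j) = fun u => (W u * (A u)⁻¹) i j :=
    funext fun u => (Matrix.mul_apply).symm
  rw [hfun] at h1
  exact h1

/-- The law of a matrix with independent standard Gaussian entries, listed as a vector. -/
noncomputable abbrev gaussMat (ν ι : Type*) [Fintype ν] [Fintype ι] : Measure (ν × ι → ℝ) :=
  Measure.pi fun _ : ν × ι => gaussianReal 0 1

/-- The inverse of a regularized Gram matrix. -/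
noncomputable def regInv (ε : ℝ) (W : Matrix ν ι ℝ) : Matrix ι ι ℝ :=
  (Wᵀ * W + ε • (1 : Matrix ι ι ℝ))⁻¹

lemma measurable_regInv (ε : ℝ) (i j : ι) :
    Measurable fun x : ν × ι → ℝ => regInv ε (toMat x) i j := by
  refine measurable_inv_apply (fun a b => ?_) i j
  simp only [Matrix.add_apply]
  exact (measurable_mul_apply (fun c d => measurable_toMat d c) measurable_toMat a b).add_const _

/-- Stein's identity for `tr (Wᵀ W (Wᵀ W + ε)⁻¹)`. -/
lemma integral_regularized {ε : ℝ} (hε : 0 < ε) :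
    Integrable (fun x => (regInv ε (toMat x)).trace) (gaussMat ν ι) ∧
    Integrable (fun x => ((Fintype.card ν : ℝ) - Fintype.card ι - 1) * (regInv ε (toMat x)).trace +
        ε * ((regInv ε (toMat x)).trace ^ 2 + (regInv ε (toMat x) * regInv ε (toMat x)).trace))
      (gaussMat ν ι) ∧
    ∫ x, (((Fintype.card ν : ℝ) - Fintype.card ι - 1) * (regInv ε (toMat x)).trace +
        ε * ((regInv ε (toMat x)).trace ^ 2 + (regInv ε (toMat x) * regInv ε (toMat x)).trace))
          ∂(gaussMat ν ι) =
      ∫ x, ((Fintype.card ι : ℝ) - ε * (regInv ε (toMat x)).trace) ∂(gaussMat ν ι) := by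
  classical
  have hmW := measurable_toMat (ν := ν) (ι := ι)
  have hmB := measurable_regInv (ν := ν) (ι := ι) ε
  have hmWB := measurable_mul_apply hmW hmB
  have hmH : ∀ i j, Measurable fun x : ν × ι → ℝ =>
      (toMat x * regInv ε (toMat x) * (toMat x)ᵀ) i j :=
    measurable_mul_apply hmWB fun i j => hmW j i
  have st : ∀ (i : ν) (j : ι), _ := fun i j =>
    stein_pi (i, j) (F := fun x : ν × ι → ℝ => (toMat x * regInv ε (toMat x)) i j)
      (F' := fun x => regInv ε (toMat x) j j - (toMat x * regInv ε (toMat x)) i j ^ 2 -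
        (toMat x * regInv ε (toMat x) * (toMat x)ᵀ) i i * regInv ε (toMat x) j j)
      -- The square of the function is at most `ε⁻¹ ≤ (1 + ε⁻¹)²`. Each of the three terms of the
      -- derivative is at most `ε⁻¹` in absolute value.
      (C := 1 + ε⁻¹) (C' := 3 * ε⁻¹)
      (fun x s => hasDerivAt_regularized hε i j x s) (hmWB i j)
      (((hmB j j).sub ((hmWB i j).pow_const 2)).sub ((hmH i i).mul (hmB j j)))
      (fun x => by
        obtain ⟨b0, b1, b2⟩ := regularized_diag_bounds (toMat x) hε rfl j
        have : 0 < ε⁻¹ := by positivity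
        refine abs_le_of_sq_le_sq (((b2 i).trans b1).trans (by nlinarith)) (by positivity))
      (fun x => by
        obtain ⟨b0, b1, b2⟩ := regularized_diag_bounds (toMat x) hε rfl j
        obtain ⟨b3, b4⟩ := regularized_hat_bounds (toMat x) hε rfl i
        have h8 := b2 i
        have h5 := mul_le_mul b4 b1 b0 zero_le_one
        have h6 := mul_nonneg b3 b0
        have h7 := sq_nonneg ((toMat x * ((toMat x)ᵀ * toMat x + ε • (1 : Matrix ι ι ℝ))⁻¹) i j)
        rw [abs_le]
        simp only [regInv]
        constructor <;> linarith)
  have hT : Integrable (fun x => (regInv ε (toMat x)).trace) (gaussMat ν ι) := by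
    refine integrable_finsetSum _ fun j _ => ?_
    refine Integrable.of_bound (hmB j j).aestronglyMeasurable (ε⁻¹) (ae_of_all _ fun x => ?_)
    obtain ⟨b0, b1, -⟩ := regularized_diag_bounds (toMat x) hε rfl j
    exact (abs_of_nonneg b0).le.trans b1
  refine ⟨hT, ?_⟩
  have hint := integrable_finsetSum Finset.univ fun i _ =>
    integrable_finsetSum Finset.univ fun j _ => (st i j).2.1
  have hsum : ∑ i : ν, ∑ j : ι, ∫ x, x (i, j) * (toMat x * regInv ε (toMat x)) i j
      ∂(gaussMat ν ι) = ∑ i : ν, ∑ j : ι, ∫ x, (regInv ε (toMat x) j j -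
        (toMat x * regInv ε (toMat x)) i j ^ 2 -
        (toMat x * regInv ε (toMat x) * (toMat x)ᵀ) i i * regInv ε (toMat x) j j)
      ∂(gaussMat ν ι) :=
    Finset.sum_congr rfl fun i _ => Finset.sum_congr rfl fun j _ => (st i j).2.2
  simp_rw [← integral_finsetSum _ fun j _ => (st _ j).1,
    ← integral_finsetSum _ fun j _ => (st _ j).2.1] at hsum
  rw [← integral_finsetSum _ fun i _ => integrable_finsetSum _ fun j _ => (st i j).1,
    ← integral_finsetSum _ fun i _ => integrable_finsetSum _ fun j _ => (st i j).2.1] at hsum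
  have tr2 : ∀ x : ν × ι → ℝ, ((toMat x)ᵀ * (toMat x * regInv ε (toMat x))).trace =
      (Fintype.card ι : ℝ) - ε * (regInv ε (toMat x)).trace := fun x => by
    obtain ⟨hs, h2, h3⟩ := regularized_self (toMat x) hε (B := regInv ε (toMat x)) rfl
    rw [← Matrix.mul_assoc, h2]; simp
  have eL : ∀ x : ν × ι → ℝ, ∑ i : ν, ∑ j : ι, x (i, j) * (toMat x * regInv ε (toMat x)) i j =
      (Fintype.card ι : ℝ) - ε * (regInv ε (toMat x)).trace := fun x => by
    rw [← tr2, Finset.sum_comm]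
    simp [Matrix.trace, Matrix.mul_apply (M := (toMat x)ᵀ)]
  -- With `b = tr B` and `b₂ = tr B²`, the three double sums are `ν b`, `b - ε b₂` and `(r - ε b)
  -- b`.
  have eR : ∀ x : ν × ι → ℝ, ∑ i : ν, ∑ j : ι, (regInv ε (toMat x) j j -
        (toMat x * regInv ε (toMat x)) i j ^ 2 -
        (toMat x * regInv ε (toMat x) * (toMat x)ᵀ) i i * regInv ε (toMat x) j j) =
      ((Fintype.card ν : ℝ) - Fintype.card ι - 1) * (regInv ε (toMat x)).trace +
        ε * ((regInv ε (toMat x)).trace ^ 2 +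
          (regInv ε (toMat x) * regInv ε (toMat x)).trace) := fun x => by
    obtain ⟨hs, h2, h3⟩ := regularized_self (toMat x) hε (B := regInv ε (toMat x)) rfl
    have t1 : ∑ i : ν, ∑ j : ι, (toMat x * regInv ε (toMat x)) i j ^ 2 =
        (regInv ε (toMat x)).trace - ε * (regInv ε (toMat x) * regInv ε (toMat x)).trace := by
      have := congrArg Matrix.trace h3
      rw [Matrix.trace_add, Matrix.trace_smul, hs, smul_eq_mul] at this
      rw [this, add_sub_cancel_right, Finset.sum_comm]
      simp [Matrix.trace, Matrix.mul_apply (M := (toMat x * regInv ε (toMat x))ᵀ),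
        sq, -transpose_mul]
    have t2 : ∑ i : ν, (toMat x * regInv ε (toMat x) * (toMat x)ᵀ) i i =
        (Fintype.card ι : ℝ) - ε * (regInv ε (toMat x)).trace := by
      rw [← tr2, Matrix.trace_mul_comm]; rfl
    simp only [Finset.sum_sub_distrib, t1, ← Finset.mul_sum, ← Finset.sum_mul, t2]
    simp only [Finset.sum_const, Finset.card_univ, nsmul_eq_mul]
    change _ * (regInv ε (toMat x)).trace - _ - _ * (regInv ε (toMat x)).trace = _
    ring
  simp_rw [eL, eR] at hsum
  simp_rw [eR] at hint
  exact ⟨hint, hsum.symm⟩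

/-- In terms of the eigenvalues `l i ≥ 0` of the Gram matrix, each `ε / (l i + ε)` is at most `1`,
and a sum of squares of nonnegative numbers is at most the square of their sum. -/
lemma trace_regInv_bounds (W : Matrix ν ι ℝ) {ε : ℝ} (hε : 0 < ε) :
    0 ≤ (regInv ε W).trace ∧ ε * (regInv ε W).trace ≤ Fintype.card ι ∧
      0 ≤ (regInv ε W * regInv ε W).trace ∧
      (regInv ε W * regInv ε W).trace ≤ (regInv ε W).trace ^ 2 := by
  obtain ⟨l, hl, -, h⟩ := exists_trace_regularized_eq W
  obtain ⟨h1, h2⟩ := h ε fun i => (add_pos_of_nonneg_of_pos (hl i) hε).ne'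
  have hp : ∀ i, 0 ≤ (l i + ε)⁻¹ := fun i =>
    inv_nonneg.2 (add_pos_of_nonneg_of_pos (hl i) hε).le
  simp only [regInv, h1, h2]
  refine ⟨Finset.sum_nonneg fun i _ => hp i, ?_, Finset.sum_nonneg fun i _ => sq_nonneg _,
    Finset.sum_sq_le_sq_sum_of_nonneg fun i _ => hp i⟩
  rw [Finset.mul_sum]
  calc ∑ i, ε * (l i + ε)⁻¹ ≤ ∑ _i : ι, (1 : ℝ) := Finset.sum_le_sum fun i _ => by
        rw [mul_inv_le_iff₀ (add_pos_of_nonneg_of_pos (hl i) hε)]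
        linarith [hl i]
    _ = _ := by simp

/-- A vanishing eigenvalue alone contributes `ε⁻¹`. A singular Gram matrix therefore makes the trace
blow up, which a bounded expectation excludes almost surely. -/
lemma inv_le_trace_regInv {W : Matrix ν ι ℝ} (hW : (Wᵀ * W).det = 0) {ε : ℝ} (hε : 0 < ε) :
    ε⁻¹ ≤ (regInv ε W).trace := by
  obtain ⟨l, hl, hd, h⟩ := exists_trace_regularized_eq W
  obtain ⟨h1, -⟩ := h ε fun i => (add_pos_of_nonneg_of_pos (hl i) hε).ne'
  rw [hd, Finset.prod_eq_zero_iff] at hW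
  obtain ⟨i, -, hi⟩ := hW
  rw [regInv, h1]
  have := Finset.single_le_sum (f := fun i => (l i + ε)⁻¹)
    (fun i _ => inv_nonneg.2 (add_pos_of_nonneg_of_pos (hl i) hε).le) (Finset.mem_univ i)
  simpa [hi] using this

lemma trace_regInv_le {W : Matrix ν ι ℝ} (hW : (Wᵀ * W).det ≠ 0) {ε : ℝ} (hε : 0 < ε) :
    (regInv ε W).trace ≤ ((Wᵀ * W)⁻¹).trace := by
  obtain ⟨l, hl, hd, h⟩ := exists_trace_regularized_eq W
  rw [hd, Finset.prod_ne_zero_iff] at hW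
  have hp : ∀ i, 0 < l i := fun i => lt_of_le_of_ne (hl i) (hW i (Finset.mem_univ i)).symm
  obtain ⟨h1, -⟩ := h ε fun i => (add_pos_of_nonneg_of_pos (hl i) hε).ne'
  obtain ⟨h2, -⟩ := h 0 fun i => by simpa using (hp i).ne'
  simp only [zero_smul, add_zero] at h2
  rw [regInv, h1, h2]
  refine Finset.sum_le_sum fun i _ => ?_
  exact inv_anti₀ (hp i) (by linarith)

lemma tendsto_trace_regInv {W : Matrix ν ι ℝ} (hW : (Wᵀ * W).det ≠ 0) :
    Filter.Tendsto (fun n : ℕ => (regInv (1 / ((n : ℝ) + 1)) W).trace) Filter.atTop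
      (nhds ((Wᵀ * W)⁻¹).trace) := by
  obtain ⟨l, hl, hd, h⟩ := exists_trace_regularized_eq W
  rw [hd, Finset.prod_ne_zero_iff] at hW
  have hp : ∀ i, 0 < l i := fun i => lt_of_le_of_ne (hl i) (hW i (Finset.mem_univ i)).symm
  have e : ∀ n : ℕ, (regInv (1 / ((n : ℝ) + 1)) W).trace = ∑ i, (l i + 1 / ((n : ℝ) + 1))⁻¹ :=
    fun n => (h _ fun i => (add_pos (hp i) Nat.one_div_pos_of_nat).ne').1
  obtain ⟨h2, -⟩ := h 0 fun i => by simpa using (hp i).ne'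
  simp only [zero_smul, add_zero] at h2
  simp only [e, h2]
  refine tendsto_finsetSum _ fun i _ => Filter.Tendsto.inv₀ ?_ (hp i).ne'
  simpa using tendsto_one_div_add_atTop_nhds_zero_nat.const_add (l i)

/-- The inverse Wishart expectation: almost surely the Gram matrix of a Gaussian matrix is
invertible, and the trace of its inverse has mean `r / (ν - r - 1)`. -/
theorem inverse_wishart (h : Fintype.card ι + 1 < Fintype.card ν) :
    (∀ᵐ x ∂gaussMat ν ι, ((toMat x)ᵀ * toMat x).det ≠ 0) ∧
    Integrable (fun x => (((toMat x)ᵀ * toMat x)⁻¹).trace) (gaussMat ν ι) ∧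
    ∫ x, (((toMat x)ᵀ * toMat x)⁻¹).trace ∂(gaussMat ν ι) =
      (Fintype.card ι : ℝ) / ((Fintype.card ν : ℝ) - Fintype.card ι - 1) := by
  set P := gaussMat ν ι with hP
  set c : ℝ := (Fintype.card ν : ℝ) - Fintype.card ι - 1 with hc
  have hc0 : 0 < c := by
    have : ((Fintype.card ι : ℝ) + 1) < Fintype.card ν := by exact_mod_cast h
    rw [hc]; linarith
  set r : ℝ := (Fintype.card ι : ℝ) with hr
  have hr0 : 0 ≤ r := Nat.cast_nonneg _
  set T : ℕ → (ν × ι → ℝ) → ℝ := fun n x => (regInv (1 / ((n : ℝ) + 1)) (toMat x)).trace with hT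
  set T0 : (ν × ι → ℝ) → ℝ := fun x => (((toMat x)ᵀ * toMat x)⁻¹).trace with hT0
  set Q : ℕ → (ν × ι → ℝ) → ℝ := fun n x =>
    (regInv (1 / ((n : ℝ) + 1)) (toMat x) * regInv (1 / ((n : ℝ) + 1)) (toMat x)).trace with hQ
  have hε : ∀ n : ℕ, (0 : ℝ) < 1 / ((n : ℝ) + 1) := fun n => Nat.one_div_pos_of_nat
  have hTm : ∀ n, Measurable (T n) := fun n => measurable_trace (measurable_regInv _)
  have hT0m : Measurable T0 := by
    -- At `ε = 0` the regularized inverse is the plain one, so its measurability is already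
    -- available.
    have : T0 = fun x => (regInv 0 (toMat x)).trace := by
      ext x; simp [hT0, regInv]
    rw [this]; exact measurable_trace (measurable_regInv _)
  have hid := fun n => integral_regularized (ν := ν) (ι := ι) (hε n)
  have hb := fun n x => trace_regInv_bounds (toMat (ν := ν) (ι := ι) x) (hε n)
  have hle : ∀ n, ∫ x, T n x ∂P ≤ r / c := by
    intro n
    obtain ⟨i1, i2, i3⟩ := hid n
    -- The term carrying `ε` in Stein's identity is nonnegative. Dropping it bounds `𝔼 T n` by `r /
    -- c` uniformly in `n`.
    have a1 : ∫ x, c * T n x ∂P ≤ ∫ x, (c * T n x + 1 / ((n : ℝ) + 1) * (T n x ^ 2 + Q n x)) ∂P :=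
      integral_mono (i1.const_mul c) i2 fun x => by
        have h1 : 0 ≤ Q n x := (hb n x).2.2.1
        have := mul_nonneg (hε n).le (add_nonneg (sq_nonneg (T n x)) h1)
        exact le_add_of_nonneg_right this
    have a2 : ∫ x, (r - 1 / ((n : ℝ) + 1) * T n x) ∂P ≤ r := by
      calc _ ≤ ∫ _x, r ∂P := integral_mono ((integrable_const r).sub (i1.const_mul _))
            (integrable_const r) fun x => by
              simpa using mul_nonneg (hε n).le (hb n x).1
        _ = r := by simp
    rw [integral_const_mul] at a1
    rw [le_div_iff₀ hc0, mul_comm]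
    exact a1.trans (i3.le.trans a2)
  -- Fatou's lemma carries the uniform bound to the limit. Finiteness of the limit excludes singular
  -- Gram matrices, and off that null set the limit is `T0`, which is thereby integrable.
  have hfat : ∫⁻ x, Filter.liminf (fun n => ENNReal.ofReal (T n x)) Filter.atTop ∂P
      ≤ ENNReal.ofReal (r / c) := by
    refine (lintegral_liminf_le fun n => (hTm n).ennreal_ofReal).trans ?_
    refine Filter.liminf_le_of_frequently_le' (Filter.Frequently.of_forall fun n => ?_)
    rw [← ofReal_integral_eq_lintegral_ofReal (hid n).1 (ae_of_all _ fun x => (hb n x).1)]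
    exact ENNReal.ofReal_le_ofReal (hle n)
  have hinv : ∀ᵐ x ∂P, ((toMat x)ᵀ * toMat x).det ≠ 0 := by
    have := ae_lt_top (Measurable.liminf fun n => (hTm n).ennreal_ofReal)
      (hfat.trans_lt ENNReal.ofReal_lt_top).ne
    filter_upwards [this] with x hx hdet
    refine hx.ne (Filter.Tendsto.liminf_eq ?_)
    have h1 : Filter.Tendsto (fun n => T n x) Filter.atTop Filter.atTop := by
      refine Filter.tendsto_atTop_mono (fun n => inv_le_trace_regInv hdet (hε n)) ?_
      simp only [one_div, inv_inv]
      exact Filter.tendsto_atTop_add_const_right _ _ tendsto_natCast_atTop_atTop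
    exact ENNReal.tendsto_ofReal_atTop.comp h1
  have hT00 : 0 ≤ᵐ[P] T0 := by
    filter_upwards [hinv] with x hx
    exact (hb 0 x).1.trans (trace_regInv_le hx (hε 0))
  have hint : Integrable T0 P := by
    refine ⟨hT0m.aestronglyMeasurable, ?_⟩
    rw [hasFiniteIntegral_iff_ofReal hT00]
    refine lt_of_le_of_lt (le_trans (le_of_eq ?_) hfat) ENNReal.ofReal_lt_top
    refine lintegral_congr_ae ?_
    filter_upwards [hinv] with x hx
    exact (Filter.Tendsto.liminf_eq
      ((ENNReal.continuous_ofReal.tendsto _).comp (tendsto_trace_regInv hx))).symm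
  refine ⟨hinv, hint, ?_⟩
  have htend0 : Filter.Tendsto (fun n : ℕ => 1 / ((n : ℝ) + 1)) Filter.atTop (nhds 0) :=
    tendsto_one_div_add_atTop_nhds_zero_nat
  have hlim1 : Filter.Tendsto (fun n => ∫ x, (c * T n x + 1 / ((n : ℝ) + 1) *
      (T n x ^ 2 + Q n x)) ∂P) Filter.atTop (nhds (∫ x, c * T0 x ∂P)) := by
    -- The dominating function comes from `Q ≤ T²`, `ε T ≤ r` and `T ≤ T0`, which give `ε (T² + Q) ≤
    -- 2 (ε T) T ≤ 2 r T0`.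
    refine tendsto_integral_of_dominated_convergence (fun x => (c + 2 * r) * T0 x)
      (fun n => (hid n).2.1.1) (hint.const_mul _) (fun n => ?_) ?_
    · filter_upwards [hinv] with x hx
      obtain ⟨b1, b2, b3, b4⟩ := hb n x
      have b5 := trace_regInv_le hx (hε n)
      change 0 ≤ T n x at b1
      change _ * T n x ≤ r at b2
      change 0 ≤ Q n x at b3
      change Q n x ≤ T n x ^ 2 at b4
      change T n x ≤ T0 x at b5
      have h1 : 1 / ((n : ℝ) + 1) * (T n x ^ 2 + Q n x) ≤ 2 * r * T0 x := by
        calc 1 / ((n : ℝ) + 1) * (T n x ^ 2 + Q n x)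
            ≤ 1 / ((n : ℝ) + 1) * (T n x ^ 2 + T n x ^ 2) :=
              mul_le_mul_of_nonneg_left (by linarith) (hε n).le
          _ = 2 * ((1 / ((n : ℝ) + 1) * T n x) * T n x) := by ring
          _ ≤ 2 * (r * T0 x) := by
              have := mul_le_mul b2 b5 b1 hr0
              linarith
          _ = _ := by ring
      have h0 := mul_nonneg (hε n).le (add_nonneg (sq_nonneg (T n x)) b3)
      have h2 := mul_le_mul_of_nonneg_left b5 hc0.le
      have h3 := mul_nonneg hc0.le b1
      rw [Real.norm_eq_abs, abs_of_nonneg (add_nonneg h3 h0)]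
      linarith
    · filter_upwards [hinv] with x hx
      have t1 : Filter.Tendsto (fun n => T n x) Filter.atTop (nhds (T0 x)) :=
        tendsto_trace_regInv hx
      have t2 : Filter.Tendsto (fun n : ℕ => 1 / ((n : ℝ) + 1) * (T n x ^ 2 + Q n x)) Filter.atTop
          (nhds 0) := by
        have u1 : Filter.Tendsto (fun n : ℕ => 1 / ((n : ℝ) + 1) * (T n x ^ 2 + T n x ^ 2))
            Filter.atTop (nhds 0) := by
          simpa using htend0.mul ((t1.pow 2).add (t1.pow 2))
        refine squeeze_zero (fun n => ?_) (fun n => ?_) u1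
        · exact mul_nonneg (hε n).le (add_nonneg (sq_nonneg _) (hb n x).2.2.1)
        · exact mul_le_mul_of_nonneg_left (add_le_add le_rfl (hb n x).2.2.2) (hε n).le
      simpa using (t1.const_mul c).add t2
  have hlim2 : Filter.Tendsto (fun n : ℕ => ∫ x, (r - 1 / ((n : ℝ) + 1) * T n x) ∂P) Filter.atTop
      (nhds (∫ _x, r ∂P)) := by
    refine tendsto_integral_of_dominated_convergence (fun _ => r)
      (fun n => ((integrable_const r).sub ((hid n).1.const_mul _)).1) (integrable_const r)
      (fun n => ae_of_all _ fun x => ?_) ?_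
    · obtain ⟨b1, b2, -, -⟩ := hb n x
      have b3 := mul_nonneg (hε n).le b1
      rw [Real.norm_eq_abs, abs_le]
      constructor
      · linarith
      · change r - _ ≤ r
        linarith
    · filter_upwards [hinv] with x hx
      have t1 : Filter.Tendsto (fun n => T n x) Filter.atTop (nhds (T0 x)) :=
        tendsto_trace_regInv hx
      simpa using (htend0.mul t1).const_sub r
  have heq := tendsto_nhds_unique hlim1 (hlim2.congr fun n => (hid n).2.2.symm)
  rw [integral_const_mul] at heq
  simp only [integral_const, probReal_univ, one_smul] at heq
  rw [eq_div_iff hc0.ne', mul_comm]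
  exact heq

end Wishart

/-! ### Second moments of products of independent random matrices -/

section SecondMoment

variable {Ω : Type*} [MeasurableSpace Ω] {μ : Measure Ω}

lemma frobSq_nonneg {α β : Type*} [Fintype α] [Fintype β] (A : Matrix α β ℝ) : 0 ≤ frobSq A :=
  Finset.sum_nonneg fun _ _ => Finset.sum_nonneg fun _ _ => sq_nonneg _

lemma sq_le_frobSq {α β : Type*} [Fintype α] [Fintype β] (A : Matrix α β ℝ) (a : α) (b : β) :
    A a b ^ 2 ≤ frobSq A :=
  (Finset.single_le_sum (f := fun b => A a b ^ 2) (fun _ _ => sq_nonneg _)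
    (Finset.mem_univ b)).trans
    (Finset.single_le_sum (f := fun a => ∑ b, A a b ^ 2)
      (fun _ _ => Finset.sum_nonneg fun _ _ => sq_nonneg _) (Finset.mem_univ a))

lemma frobSq_eq_trace {α β : Type*} [Fintype α] [Fintype β] (A : Matrix α β ℝ) :
    frobSq A = (A * Aᵀ).trace := by
  simp [frobSq, Matrix.trace, Matrix.mul_apply, sq]

lemma frobSq_eq_trace' {α β : Type*} [Fintype α] [Fintype β] (A : Matrix α β ℝ) :
    frobSq A = (Aᵀ * A).trace := by
  rw [frobSq_eq_trace, Matrix.trace_mul_comm]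

lemma frobSq_transpose {α β : Type*} [Fintype α] [Fintype β] (A : Matrix α β ℝ) :
    frobSq Aᵀ = frobSq A := by
  rw [frobSq_eq_trace, frobSq_eq_trace', Matrix.transpose_transpose]

lemma memLp_apply_of_integrable_frobSq {α β : Type*} [Fintype α] [Fintype β]
    {A : Ω → Matrix α β ℝ} (hm : ∀ a b, AEStronglyMeasurable (fun ω => A ω a b) μ)
    (hA : Integrable (fun ω => frobSq (A ω)) μ) (a : α) (b : β) :
    MemLp (fun ω => A ω a b) 2 μ := by
  rw [memLp_two_iff_integrable_sq (hm a b)]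
  refine hA.mono ((hm a b).pow 2) (ae_of_all _ fun ω => ?_)
  rw [Real.norm_of_nonneg (sq_nonneg _), Real.norm_of_nonneg (frobSq_nonneg _)]
  exact sq_le_frobSq _ _ _

variable {α ν τ β : Type*} [Fintype α] [Fintype ν] [DecidableEq ν] [Fintype τ] [MeasurableSpace β]
  {w : Ω → β} {φ : β → Matrix α ν ℝ} {N : Ω → Matrix ν τ ℝ} {c : ℝ}

/-- If `N` is independent of `w` and `𝔼[N Nᵀ] = c I`, then
`𝔼 ‖φ(w) N‖² = c 𝔼 ‖φ(w)‖²`. -/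
theorem integral_frobSq_mul (hw : AEMeasurable w μ) (hφ : ∀ a l, Measurable fun x => φ x a l)
    (hφi : Integrable (fun ω => frobSq (φ (w ω))) μ)
    (hN : ∀ l t, MemLp (fun ω => N ω l t) 2 μ)
    (hI : IndepFun w (fun ω => (fun l t => N ω l t : ν → τ → ℝ)) μ)
    (hc : ∀ l l', ∫ ω, (N ω * (N ω)ᵀ) l l' ∂μ = (c • (1 : Matrix ν ν ℝ)) l l') :
    Integrable (fun ω => frobSq (φ (w ω) * N ω)) μ ∧
      ∫ ω, frobSq (φ (w ω) * N ω) ∂μ = c * ∫ ω, frobSq (φ (w ω)) ∂μ := by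
  have hM := memLp_apply_of_integrable_frobSq (A := fun ω => φ (w ω))
    (fun a l => ((hφ a l).comp_aemeasurable hw).aestronglyMeasurable) hφi
  have e : ∀ ω, frobSq (φ (w ω) * N ω) =
      ∑ a, ∑ l, ∑ l', (φ (w ω) a l * φ (w ω) a l') * (N ω * (N ω)ᵀ) l l' := by
    intro ω
    rw [frobSq_eq_trace, Matrix.transpose_mul, Matrix.mul_assoc, ← Matrix.mul_assoc (N ω)]
    simp only [Matrix.trace, Matrix.diag, Matrix.mul_apply (M := φ (w ω)),
      Matrix.mul_apply (M := N ω * (N ω)ᵀ), Finset.mul_sum, Matrix.transpose_apply]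
    refine Finset.sum_congr rfl fun a _ => Finset.sum_congr rfl fun l _ =>
      Finset.sum_congr rfl fun l' _ => ?_
    ring
  have hMM : ∀ a l l', Integrable (fun ω => φ (w ω) a l * φ (w ω) a l') μ := fun a l l' =>
    (hM a l).integrable_mul (hM a l')
  have hNN : ∀ l l', Integrable (fun ω => (N ω * (N ω)ᵀ) l l') μ := fun l l' => by
    simp only [Matrix.mul_apply, Matrix.transpose_apply]
    exact integrable_finsetSum _ fun t _ => (hN l t).integrable_mul (hN l' t)
  have hind : ∀ a l l', IndepFun (fun ω => φ (w ω) a l * φ (w ω) a l')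
      (fun ω => (N ω * (N ω)ᵀ) l l') μ := fun a l l' => by
    have h2 : Measurable fun x : ν → τ → ℝ => (Matrix.of x * (Matrix.of x)ᵀ) l l' :=
      measurable_mul_apply (A := fun x : ν → τ → ℝ => Matrix.of x)
        (B := fun x : ν → τ → ℝ => (Matrix.of x)ᵀ)
        (fun i j => (measurable_pi_apply j).comp (measurable_pi_apply i))
        (fun j i => (measurable_pi_apply j).comp (measurable_pi_apply i)) l l'
    exact hI.comp (φ := fun x => φ x a l * φ x a l') ((hφ a l).mul (hφ a l')) h2
  have hint : ∀ a l l', Integrable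
      (fun ω => (φ (w ω) a l * φ (w ω) a l') * (N ω * (N ω)ᵀ) l l') μ := fun a l l' =>
    (hind a l l').integrable_mul (hMM a l l') (hNN l l')
  simp only [e]
  refine ⟨integrable_finsetSum _ fun a _ => integrable_finsetSum _ fun l _ =>
    integrable_finsetSum _ fun l' _ => hint a l l', ?_⟩
  rw [integral_finsetSum _ fun a _ => integrable_finsetSum _ fun l _ =>
    integrable_finsetSum _ fun l' _ => hint a l l']
  simp only [frobSq]
  rw [integral_finsetSum _ fun a _ => integrable_finsetSum _ fun l _ => (hM a l).integrable_sq,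
    Finset.mul_sum]
  refine Finset.sum_congr rfl fun a _ => ?_
  rw [integral_finsetSum _ fun l _ => integrable_finsetSum _ fun l' _ => hint a l l',
    integral_finsetSum _ fun l _ => (hM a l).integrable_sq, Finset.mul_sum]
  refine Finset.sum_congr rfl fun l _ => ?_
  -- Only the diagonal survives: by independence each expectation factors, and the second moments of
  -- `N` vanish for `l' ≠ l`.
  rw [integral_finsetSum _ fun l' _ => hint a l l', Finset.sum_eq_single l]
  · rw [(hind a l l).integral_fun_mul_eq_mul_integral (hMM a l l).1 (hNN l l).1, hc, mul_comm]
    simp [sq]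
  · intro l' _ hl
    rw [(hind a l l').integral_fun_mul_eq_mul_integral (hMM a l l').1 (hNN l l').1, hc]
    simp [hl.symm]
  · simp

end SecondMoment

/-- If `N` is centered and independent of `w`, then `φ(w) N` is centered. -/
theorem integral_mul_apply_eq_zero {Ω α ν τ β : Type*} [MeasurableSpace Ω] {μ : Measure Ω}
    [Fintype ν] [MeasurableSpace β] {w : Ω → β} {φ : β → Matrix α ν ℝ} {N : Ω → Matrix ν τ ℝ}
    (hφ : ∀ a l, Measurable fun x => φ x a l)
    (hφi : ∀ a l, Integrable (fun ω => φ (w ω) a l) μ)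
    (hN : ∀ l t, Integrable (fun ω => N ω l t) μ)
    (hI : IndepFun w (fun ω => (fun l t => N ω l t : ν → τ → ℝ)) μ)
    (hc : ∀ l t, ∫ ω, N ω l t ∂μ = 0) (a : α) (t : τ) :
    Integrable (fun ω => (φ (w ω) * N ω) a t) μ ∧ ∫ ω, (φ (w ω) * N ω) a t ∂μ = 0 := by
  have hind : ∀ l, IndepFun (fun ω => φ (w ω) a l) (fun ω => N ω l t) μ := fun l =>
    hI.comp (φ := fun x => φ x a l) (ψ := fun x : ν → τ → ℝ => x l t) (hφ a l)
      ((measurable_pi_apply t).comp (measurable_pi_apply l))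
  have hint : ∀ l, Integrable (fun ω => φ (w ω) a l * N ω l t) μ := fun l =>
    (hind l).integrable_mul (hφi a l) (hN l t)
  simp only [Matrix.mul_apply]
  refine ⟨integrable_finsetSum _ fun l _ => hint l, ?_⟩
  rw [integral_finsetSum _ fun l _ => hint l]
  refine Finset.sum_eq_zero fun l _ => ?_
  rw [(hind l).integral_fun_mul_eq_mul_integral (hφi a l).1 (hN l t).1, hc, mul_zero]

/-! ### Independence -/

section Independence

variable {Ω : Type*} [MeasurableSpace Ω] {μ : Measure Ω}

/-- The law of the triple is a product of three laws, and reassociating that product gives the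
claim. -/
lemma indepFun_prodMk_of_indepFun {α β γ : Type*} [MeasurableSpace α] [MeasurableSpace β]
    [MeasurableSpace γ] [IsProbabilityMeasure μ] {f : Ω → α} {g : Ω → β} {h : Ω → γ}
    (hf : AEMeasurable f μ) (hg : AEMeasurable g μ) (hh : AEMeasurable h μ)
    (hfg : IndepFun f g μ) (hfgh : IndepFun (fun ω => (f ω, g ω)) h μ) :
    IndepFun f (fun ω => (g ω, h ω)) μ := by
  have := Measure.isProbabilityMeasure_map hf
  have := Measure.isProbabilityMeasure_map hg
  have := Measure.isProbabilityMeasure_map hh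
  have hgh : IndepFun g h μ := hfgh.comp measurable_snd measurable_id
  rw [indepFun_iff_map_prod_eq_prod_map_map hf (hg.prodMk hh),
    (indepFun_iff_map_prod_eq_prod_map_map hg hh).1 hgh, ← Measure.prodAssoc_prod,
    ← (indepFun_iff_map_prod_eq_prod_map_map hf hg).1 hfg,
    ← (indepFun_iff_map_prod_eq_prod_map_map (hf.prodMk hg) hh).1 hfgh,
    AEMeasurable.map_map_of_aemeasurable MeasurableEquiv.prodAssoc.measurable.aemeasurable
      ((hf.prodMk hg).prodMk hh)]
  rfl

variable {T S : Type*} [Fintype T] [Fintype S] {w : Ω → T → ℝ} {γ : Measure ℝ}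
  [IsProbabilityMeasure γ]

lemma iIndepFun_of_hasLaw_pi (hw : HasLaw w (Measure.pi fun _ => γ) μ) :
    iIndepFun (fun t ω => w ω t) μ ∧ ∀ t, HasLaw (fun ω => w ω t) γ μ := by
  have := hw.isProbabilityMeasure
  have h1 : ∀ t, HasLaw (fun ω => w ω t) γ μ := fun t =>
    (measurePreserving_eval (fun _ : T => γ) t).hasLaw.comp hw
  refine ⟨(iIndepFun_iff_map_fun_eq_pi_map fun t => (h1 t).aemeasurable).2 ?_, h1⟩
  simp only [(h1 _).map_eq]
  exact hw.map_eq

lemma hasLaw_pi_comp (hw : HasLaw w (Measure.pi fun _ => γ) μ) {f : S → T}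
    (hf : Function.Injective f) :
    HasLaw (fun ω s => w ω (f s)) (Measure.pi fun _ : S => γ) μ := by
  have := hw.isProbabilityMeasure
  obtain ⟨h1, h2⟩ := iIndepFun_of_hasLaw_pi hw
  refine ⟨aemeasurable_pi_lambda _ fun s => (h2 (f s)).aemeasurable, ?_⟩
  rw [(iIndepFun_iff_map_fun_eq_pi_map fun s => (h2 (f s)).aemeasurable).1 (h1.precomp hf)]
  simp only [(h2 _).map_eq]

lemma indepFun_pi_comp {S' : Type*} [Fintype S'] (hw : HasLaw w (Measure.pi fun _ => γ) μ)
    {f : S → T} {g : S' → T} (hfg : ∀ s s', f s ≠ g s') :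
    IndepFun (fun ω s => w ω (f s)) (fun ω s => w ω (g s)) μ := by
  classical
  obtain ⟨h1, h2⟩ := iIndepFun_of_hasLaw_pi hw
  have hd : Disjoint (Finset.univ.image f) (Finset.univ.image g) := by
    rw [Finset.disjoint_left]
    intro t h h'
    obtain ⟨s, -, rfl⟩ := Finset.mem_image.1 h
    obtain ⟨s', -, h''⟩ := Finset.mem_image.1 h'
    exact hfg s s' h''.symm
  have := h1.indepFun_finset₀ _ _ hd fun t => (h2 t).aemeasurable
  exact this.comp (φ := fun x s => x ⟨f s, Finset.mem_image_of_mem f (Finset.mem_univ s)⟩)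
    (ψ := fun x s => x ⟨g s, Finset.mem_image_of_mem g (Finset.mem_univ s)⟩)
    (measurable_pi_lambda _ fun s => measurable_pi_apply _)
    (measurable_pi_lambda _ fun s => measurable_pi_apply _)

end Independence

/-! ### Linear images of a Gaussian design -/

section Design

variable {Ω : Type*} [MeasurableSpace Ω] {μ : Measure Ω} {n p m : ℕ}
  {Sigma : Matrix (Fin p) (Fin p) ℝ} {σ : ℝ} {X : Ω → Matrix (Fin n) (Fin p) ℝ}
  {E : Ω → Matrix (Fin n) (Fin m) ℝ}

/-- Independent Gaussian rows are jointly Gaussian. Joint normality is what later turns vanishing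
covariances into independence. -/
lemma GaussianModel.hasGaussianLaw (h : GaussianModel μ Sigma σ X E) :
    HasGaussianLaw (fun ω => (fun i j => X ω i j : Fin n → Fin p → ℝ)) μ := by
  refine iIndepFun.hasGaussianLaw (X := fun i ω => (X ω i : Fin p → ℝ)) (fun i => ?_) h.row_indep
  exact (h.row_law i).hasGaussianLaw.map_equiv (PiLp.continuousLinearEquiv 2 ℝ fun _ : Fin p => ℝ)

lemma GaussianModel.memLp (h : GaussianModel μ Sigma σ X E) (i : Fin n) (j : Fin p) :
    MemLp (fun ω => X ω i j) 2 μ :=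
  ((h.hasGaussianLaw.eval i).eval j).memLp_two

lemma GaussianModel.integral_eq_zero (h : GaussianModel μ Sigma σ X E) (i : Fin n) (j : Fin p) :
    ∫ ω, X ω i j ∂μ = 0 := by
  have h1 : ∫ ω, X ω i j ∂μ = ∫ x, x j ∂(multivariateGaussian 0 Sigma) :=
    (h.row_law i).integral_comp (f := fun x : EuclideanSpace ℝ (Fin p) => x j)
      (by fun_prop)
  rw [h1]
  have := ContinuousLinearMap.integral_comp_id_comm (μ := multivariateGaussian 0 Sigma)
    IsGaussian.integrable_id (EuclideanSpace.proj j : EuclideanSpace ℝ (Fin p) →L[ℝ] ℝ)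
  simpa using this

lemma GaussianModel.covariance_eq (h : GaussianModel μ Sigma σ X E) (hS : Sigma.PosSemidef)
    (i i' : Fin n) (j j' : Fin p) :
    cov[fun ω => X ω i j, fun ω => X ω i' j'; μ] = if i = i' then Sigma j j' else 0 := by
  split_ifs with hi
  · subst hi
    rw [← covariance_eval_multivariateGaussian (μ := 0) hS j j']
    exact (h.row_law i).covariance_fun_comp (f := fun x : EuclideanSpace ℝ (Fin p) => x j)
      (g := fun x : EuclideanSpace ℝ (Fin p) => x j')
      (by fun_prop) (by fun_prop)
  · exact ((h.row_indep.indepFun hi).comp (φ := fun x : Fin p → ℝ => x j)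
      (ψ := fun x : Fin p → ℝ => x j') (measurable_pi_apply j)
      (measurable_pi_apply j')).covariance_eq_zero (h.memLp i j) (h.memLp i' j')

variable {ι κ : Type*}

lemma GaussianModel.memLp_mul (h : GaussianModel μ Sigma σ X E) (A : Matrix (Fin p) ι ℝ)
    (i : Fin n) (a : ι) : MemLp (fun ω => (X ω * A) i a) 2 μ := by
  simp only [Matrix.mul_apply]
  exact memLp_finsetSum _ fun j _ => (h.memLp i j).mul_const (A j a)

lemma GaussianModel.integral_mul_eq_zero (h : GaussianModel μ Sigma σ X E)
    (A : Matrix (Fin p) ι ℝ) (i : Fin n) (a : ι) : ∫ ω, (X ω * A) i a ∂μ = 0 := by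
  have := h.hasGaussianLaw.isProbabilityMeasure
  simp only [Matrix.mul_apply]
  rw [integral_finsetSum _ fun j _ => ((h.memLp i j).integrable one_le_two).mul_const _]
  simp [integral_mul_const, h.integral_eq_zero]

lemma GaussianModel.covariance_mul (h : GaussianModel μ Sigma σ X E) (hS : Sigma.PosSemidef)
    (A : Matrix (Fin p) ι ℝ) (B : Matrix (Fin p) κ ℝ) (i i' : Fin n) (a : ι) (b : κ) :
    cov[fun ω => (X ω * A) i a, fun ω => (X ω * B) i' b; μ] =
      if i = i' then (Aᵀ * Sigma * B) a b else 0 := by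
  have := h.hasGaussianLaw.isProbabilityMeasure
  simp only [Matrix.mul_apply (M := X _)]
  rw [covariance_fun_sum_fun_sum (fun j => (h.memLp i j).mul_const (A j a))
    (fun j => (h.memLp i' j).mul_const (B j b))]
  simp only [covariance_mul_const_left, covariance_mul_const_right, h.covariance_eq hS]
  split_ifs with hi
  · simp only [Matrix.mul_apply (N := B), Matrix.mul_apply (N := Sigma), Finset.sum_mul,
      Matrix.transpose_apply]
    rw [Finset.sum_comm]
    refine Finset.sum_congr rfl fun x _ => Finset.sum_congr rfl fun y _ => by ring
  · simp

lemma GaussianModel.integral_mul_mul (h : GaussianModel μ Sigma σ X E) (hS : Sigma.PosSemidef)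
    (A : Matrix (Fin p) ι ℝ) (B : Matrix (Fin p) κ ℝ) (i i' : Fin n) (a : ι) (b : κ) :
    ∫ ω, (X ω * A) i a * (X ω * B) i' b ∂μ = if i = i' then (Aᵀ * Sigma * B) a b else 0 := by
  have := h.hasGaussianLaw.isProbabilityMeasure
  rw [← h.covariance_mul hS, covariance_eq_sub (h.memLp_mul A i a) (h.memLp_mul B i' b),
    h.integral_mul_eq_zero, zero_mul, sub_zero]
  rfl

/-- Entries of `X A`, listed as a vector, as a continuous linear function of `X`. -/
noncomputable def mulRightCLM (n : ℕ) {p : ℕ} (A : Matrix (Fin p) ι ℝ) :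
    (Fin n → Fin p → ℝ) →L[ℝ] (Fin n × ι → ℝ) :=
  ContinuousLinearMap.pi fun q => ∑ j, A j q.2 •
    ((ContinuousLinearMap.proj (R := ℝ) (φ := fun _ : Fin p => ℝ) j).comp
      (ContinuousLinearMap.proj (R := ℝ) (φ := fun _ : Fin n => Fin p → ℝ) q.1))

lemma mulRightCLM_apply (A : Matrix (Fin p) ι ℝ) (x : Matrix (Fin n) (Fin p) ℝ) (q : Fin n × ι) :
    mulRightCLM n A (fun i j => x i j) q = (x * A) q.1 q.2 := by
  simp [mulRightCLM, Matrix.mul_apply, mul_comm]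

lemma GaussianModel.hasGaussianLaw_mul [Fintype ι] (h : GaussianModel μ Sigma σ X E)
    (A : Matrix (Fin p) ι ℝ) :
    HasGaussianLaw (fun ω (q : Fin n × ι) => (X ω * A) q.1 q.2) μ := by
  have := h.hasGaussianLaw.map_fun (mulRightCLM n A)
  refine this.congr (ae_of_all _ fun ω => ?_)
  ext q
  exact mulRightCLM_apply A (X ω) q

/-- Both matrices are linear images of one Gaussian vector, and all their cross covariances are
entries of `Aᵀ Σ B` or zero. -/
lemma GaussianModel.indepFun_mul [Fintype ι] [Fintype κ] (h : GaussianModel μ Sigma σ X E)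
    (hS : Sigma.PosSemidef) {A : Matrix (Fin p) ι ℝ} {B : Matrix (Fin p) κ ℝ}
    (hAB : Aᵀ * Sigma * B = 0) :
    IndepFun (fun ω (q : Fin n × ι) => (X ω * A) q.1 q.2)
      (fun ω (q : Fin n × κ) => (X ω * B) q.1 q.2) μ := by
  refine HasGaussianLaw.indepFun_of_covariance_eval (X := fun (q : Fin n × ι) ω => (X ω * A) q.1 q.2)
    (Y := fun (q : Fin n × κ) ω => (X ω * B) q.1 q.2) ?_ fun q q' => ?_
  · have := h.hasGaussianLaw.map_fun ((mulRightCLM n A).prod (mulRightCLM n B))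
    refine this.congr (ae_of_all _ fun ω => ?_)
    refine Prod.ext ?_ ?_
    · ext q; exact mulRightCLM_apply A (X ω) q
    · ext q; exact mulRightCLM_apply B (X ω) q
  · simp [h.covariance_mul hS, hAB]

/-- The entries are jointly Gaussian, centered and uncorrelated with unit variance. -/
lemma GaussianModel.hasLaw_mul [Fintype ι] [DecidableEq ι] (h : GaussianModel μ Sigma σ X E)
    (hS : Sigma.PosSemidef) {A : Matrix (Fin p) ι ℝ} (hA : Aᵀ * Sigma * A = 1) :
    HasLaw (fun ω (q : Fin n × ι) => (X ω * A) q.1 q.2) (gaussMat (Fin n) ι) μ := by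
  have hg := h.hasGaussianLaw_mul A
  have := hg.isProbabilityMeasure
  refine ⟨hg.aemeasurable, ?_⟩
  have hi : iIndepFun (fun (q : Fin n × ι) ω => (X ω * A) q.1 q.2) μ := by
    refine HasGaussianLaw.iIndepFun_of_covariance_eq_zero hg fun q q' hq => ?_
    rw [h.covariance_mul hS, hA]
    split_ifs with h1
    · rw [Matrix.one_apply_ne]
      exact fun h2 => hq (Prod.ext h1 h2)
    · rfl
  rw [(iIndepFun_iff_map_fun_eq_pi_map fun q => (hg.eval q).aemeasurable).1 hi]
  congr 1
  ext1 q
  rw [(hg.eval q).map_eq_gaussianReal, h.integral_mul_eq_zero,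
    ← covariance_self (hg.eval q).aemeasurable, h.covariance_mul hS, hA]
  simp

end Design

/-! ### Least squares algebra -/

section Algebra

variable {ν ι τ κ : Type*} [Fintype ν] [Fintype ι] [DecidableEq ι]

lemma ols_add (Z : Matrix ν ι ℝ) (Y Y' : Matrix ν τ ℝ) : ols Z (Y + Y') = ols Z Y + ols Z Y' := by
  simp [ols, Matrix.mul_add]

lemma ols_mul_self {Z : Matrix ν ι ℝ} (hZ : (Zᵀ * Z).det ≠ 0) (D : Matrix ι τ ℝ) :
    ols Z (Z * D) = D := by
  rw [ols, ← Matrix.mul_assoc, Matrix.mul_assoc _ Zᵀ, Matrix.nonsing_inv_mul _ hZ.isUnit,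
    Matrix.one_mul]

/-- Least squares is equivariant under a change of basis of the column space, so the design may be
standardized without changing fitted values. -/
lemma ols_mul_right (W : Matrix ν ι ℝ) {T : Matrix ι ι ℝ} (hT : IsUnit T.det) (Y : Matrix ν τ ℝ) :
    ols (W * T) Y = T⁻¹ * ols W Y := by
  have h : ((W * T)ᵀ * (W * T))⁻¹ * (W * T)ᵀ = T⁻¹ * ((Wᵀ * W)⁻¹ * Wᵀ) := by
    rw [Matrix.transpose_mul, Matrix.mul_assoc Tᵀ, Matrix.mul_inv_rev, ← Matrix.mul_assoc Wᵀ,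
      Matrix.mul_inv_rev]
    have hTt : IsUnit (Tᵀ).det := by rwa [Matrix.det_transpose]
    calc T⁻¹ * (Wᵀ * W)⁻¹ * Tᵀ⁻¹ * (Tᵀ * Wᵀ)
        = T⁻¹ * (Wᵀ * W)⁻¹ * (Tᵀ⁻¹ * Tᵀ) * Wᵀ := by simp only [Matrix.mul_assoc]
      _ = _ := by rw [Matrix.nonsing_inv_mul _ hTt, Matrix.mul_one, Matrix.mul_assoc]
  rw [ols, h, ols, Matrix.mul_assoc]

lemma gram_inv_transpose (W : Matrix ν ι ℝ) : ((Wᵀ * W)⁻¹)ᵀ = (Wᵀ * W)⁻¹ := by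
  rw [Matrix.transpose_nonsing_inv, Matrix.transpose_mul, Matrix.transpose_transpose]

/-- The hat matrix `W (Wᵀ W)⁻¹ Wᵀ`. -/
noncomputable def hat (W : Matrix ν ι ℝ) : Matrix ν ν ℝ := W * ((Wᵀ * W)⁻¹ * Wᵀ)

lemma hat_transpose (W : Matrix ν ι ℝ) : (hat W)ᵀ = hat W := by
  simp only [hat, Matrix.transpose_mul, gram_inv_transpose, Matrix.transpose_transpose,
    Matrix.mul_assoc]

lemma hat_mul_hat {W : Matrix ν ι ℝ} (hW : (Wᵀ * W).det ≠ 0) : hat W * hat W = hat W := by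
  calc hat W * hat W = W * ((Wᵀ * W)⁻¹ * (Wᵀ * W) * ((Wᵀ * W)⁻¹ * Wᵀ)) := by
        simp only [hat, Matrix.mul_assoc]
    _ = _ := by rw [Matrix.nonsing_inv_mul _ hW.isUnit, Matrix.one_mul, hat]

lemma trace_hat {W : Matrix ν ι ℝ} (hW : (Wᵀ * W).det ≠ 0) :
    (hat W).trace = Fintype.card ι := by
  rw [hat, Matrix.trace_mul_comm, Matrix.mul_assoc, Matrix.nonsing_inv_mul _ hW.isUnit,
    Matrix.trace_one]

lemma frobSq_hat {W : Matrix ν ι ℝ} (hW : (Wᵀ * W).det ≠ 0) :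
    frobSq (hat W) = Fintype.card ι := by
  rw [frobSq_eq_trace, hat_transpose, hat_mul_hat hW, trace_hat hW]

lemma frobSq_one_sub_hat [DecidableEq ν] {W : Matrix ν ι ℝ} (hW : (Wᵀ * W).det ≠ 0) :
    frobSq (1 - hat W) = (Fintype.card ν : ℝ) - Fintype.card ι := by
  rw [frobSq_eq_trace, Matrix.transpose_sub, Matrix.transpose_one, hat_transpose, Matrix.sub_mul,
    Matrix.one_mul, Matrix.mul_sub, Matrix.mul_one, hat_mul_hat hW, sub_self, sub_zero,
    Matrix.trace_sub, Matrix.trace_one, trace_hat hW]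

/-- Since `P Pᵀ = 1`, the product with the transpose collapses to `(Wᵀ W)⁻¹`. It is needed for `P`
the selection of the training rows and for `P = 1`. -/
lemma frobSq_gram_inv_mul [Fintype κ] {W : Matrix ν ι ℝ} (hW : (Wᵀ * W).det ≠ 0)
    {P : Matrix ν κ ℝ} [DecidableEq ν] (hP : P * Pᵀ = 1) :
    frobSq ((Wᵀ * W)⁻¹ * Wᵀ * P) = ((Wᵀ * W)⁻¹).trace := by
  rw [frobSq_eq_trace]
  congr 1
  calc (Wᵀ * W)⁻¹ * Wᵀ * P * ((Wᵀ * W)⁻¹ * Wᵀ * P)ᵀ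
      = (Wᵀ * W)⁻¹ * Wᵀ * (P * Pᵀ) * W * (Wᵀ * W)⁻¹ := by
        simp only [Matrix.transpose_mul, gram_inv_transpose, Matrix.transpose_transpose,
          Matrix.mul_assoc]
    _ = (Wᵀ * W)⁻¹ * (Wᵀ * W) * (Wᵀ * W)⁻¹ := by
        rw [hP, Matrix.mul_one]; simp only [Matrix.mul_assoc]
    _ = _ := by rw [Matrix.nonsing_inv_mul _ hW.isUnit, Matrix.one_mul]

end Algebra

/-! ### Folds -/

section Folds

variable {n K : ℕ} (fold : Fin n → Fin K) (k : Fin K) {τ κ : Type*}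

/-- The rows of the identity matrix in the `k`-th fold. -/
def testSel : Matrix {i // fold i = k} (Fin n) ℝ := testPart fold k 1

/-- The rows of the identity matrix outside the `k`-th fold. -/
def trainSel : Matrix {i // fold i ≠ k} (Fin n) ℝ := trainPart fold k 1

lemma testSel_mul (A : Matrix (Fin n) τ ℝ) : testSel fold k * A = testPart fold k A := by
  ext i j
  rw [Matrix.mul_apply]
  simp [testSel, testPart, Matrix.one_apply]

lemma trainSel_mul (A : Matrix (Fin n) τ ℝ) : trainSel fold k * A = trainPart fold k A := by
  ext i j
  rw [Matrix.mul_apply]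
  simp [trainSel, trainPart, Matrix.one_apply]

lemma trainPart_toMat (x : Fin n × τ → ℝ) :
    trainPart fold k (toMat x) = toMat fun q : {i // fold i ≠ k} × τ => x (q.1.1, q.2) := rfl

lemma testSel_mul_transpose :
    testSel fold k * (testSel fold k)ᵀ = 1 := by
  rw [testSel_mul]
  ext i j
  simp [testSel, testPart, Matrix.one_apply, Subtype.ext_iff]

lemma trainSel_mul_transpose :
    trainSel fold k * (trainSel fold k)ᵀ = 1 := by
  rw [trainSel_mul]
  ext i j
  simp [trainSel, trainPart, Matrix.one_apply, Subtype.ext_iff]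

lemma trainSel_mul_testSel_transpose :
    trainSel fold k * (testSel fold k)ᵀ = 0 := by
  rw [trainSel_mul]
  ext i j
  have : ¬ (i.1 = j.1) := fun h => i.2 (by rw [h]; exact j.2)
  simp [testSel, trainPart, testPart, this]

lemma card_train {d : ℕ} (hfold : Fintype.card {i // fold i = k} = d) :
    Fintype.card {i // fold i ≠ k} = n - d := by
  have := Fintype.card_subtype_compl (fun i => fold i = k)
  rw [hfold, Fintype.card_fin] at this
  exact this

/-- The matrix mapping a response to its least squares coefficients without the `k`-th fold. -/
noncomputable def olsSel {ι : Type*} [Fintype ι] [DecidableEq ι] (W : Matrix (Fin n) ι ℝ) :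
    Matrix ι (Fin n) ℝ :=
  ((trainPart fold k W)ᵀ * trainPart fold k W)⁻¹ * (trainPart fold k W)ᵀ * trainSel fold k

/-- The matrix mapping a response to its prediction errors on the `k`-th fold. -/
noncomputable def cvSel {ι : Type*} [Fintype ι] [DecidableEq ι] (W : Matrix (Fin n) ι ℝ) :
    Matrix {i // fold i = k} (Fin n) ℝ :=
  testSel fold k - testPart fold k W * olsSel fold k W

lemma olsSel_mul {ι : Type*} [Fintype ι] [DecidableEq ι] (W : Matrix (Fin n) ι ℝ)
    (Y : Matrix (Fin n) τ ℝ) :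
    olsSel fold k W * Y = ols (trainPart fold k W) (trainPart fold k Y) := by
  rw [ols, olsSel, Matrix.mul_assoc _ (trainSel fold k), trainSel_mul]

lemma cvSel_mul {ι : Type*} [Fintype ι] [DecidableEq ι] (W : Matrix (Fin n) ι ℝ)
    (Y : Matrix (Fin n) τ ℝ) :
    cvSel fold k W * Y = testPart fold k Y -
      testPart fold k W * ols (trainPart fold k W) (trainPart fold k Y) := by
  rw [cvSel, Matrix.sub_mul, testSel_mul, Matrix.mul_assoc, olsSel_mul]

/-- Training and test selections have mutually orthogonal rows, so the error operator `Q - V P`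
satisfies `(Q - V P)(Q - V P)ᵀ = 1 + V Vᵀ`. The norm of `V` is written for its transpose so that
training rows stand on the left and test rows on the right, the form used by `integral_frobSq_mul`.
-/
lemma frobSq_cvSel {ι : Type*} [Fintype ι] [DecidableEq ι] (W : Matrix (Fin n) ι ℝ) :
    frobSq (cvSel fold k W) = Fintype.card {i // fold i = k} +
      frobSq (trainPart fold k W * ((trainPart fold k W)ᵀ * trainPart fold k W)⁻¹ *
        (testPart fold k W)ᵀ) := by
  rw [cvSel, olsSel]
  set A := trainPart fold k W with hA
  set P : Matrix {i // fold i ≠ k} (Fin n) ℝ := trainSel fold k with hP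
  set Q : Matrix {i // fold i = k} (Fin n) ℝ := testSel fold k with hQ
  set V := testPart fold k W * ((Aᵀ * A)⁻¹ * Aᵀ) with hV
  have h1 : testPart fold k W * ((Aᵀ * A)⁻¹ * Aᵀ * P) = V * P := by
    rw [hV]; simp only [Matrix.mul_assoc]
  have h2 : A * (Aᵀ * A)⁻¹ * (testPart fold k W)ᵀ = Vᵀ := by
    rw [hV]
    simp only [Matrix.transpose_mul, gram_inv_transpose, Matrix.transpose_transpose]
  have hPQ : P * Qᵀ = 0 := trainSel_mul_testSel_transpose fold k
  have hQP : Q * Pᵀ = 0 := by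
    have := congrArg Matrix.transpose hPQ
    simpa using this
  rw [h1, h2, frobSq_transpose, frobSq_eq_trace, frobSq_eq_trace]
  have : (Q - V * P) * (Q - V * P)ᵀ = 1 + V * Vᵀ := by
    rw [Matrix.transpose_sub, Matrix.transpose_mul, Matrix.sub_mul, Matrix.mul_sub, Matrix.mul_sub,
      testSel_mul_transpose, ← Matrix.mul_assoc Q, hQP, Matrix.mul_assoc V, hPQ,
      Matrix.mul_assoc V, ← Matrix.mul_assoc P, trainSel_mul_transpose]
    simp
  rw [this, Matrix.trace_add, Matrix.trace_one]

end Folds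

/-! ### Errors for a standard Gaussian design and independent noise -/

section StandardDesign

lemma integral_mul_of_hasLaw_pi {Ω T : Type*} [MeasurableSpace Ω] {μ : Measure Ω} [Fintype T]
    [DecidableEq T] {w : Ω → T → ℝ} (hw : HasLaw w (Measure.pi fun _ => gaussianReal 0 1) μ)
    (s t : T) : MemLp (fun ω => w ω s) 2 μ ∧
      ∫ ω, w ω s * w ω t ∂μ = if s = t then 1 else 0 := by
  obtain ⟨h1, h2⟩ := iIndepFun_of_hasLaw_pi hw
  have := hw.isProbabilityMeasure
  have hm : ∀ t, MemLp (fun ω => w ω t) 2 μ := fun t => (h2 t).hasGaussianLaw.memLp_two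
  have hz : ∀ t, ∫ ω, w ω t ∂μ = 0 := fun t => by
    rw [(h2 t).integral_eq]; simp
  refine ⟨hm s, ?_⟩
  have hc := covariance_eq_sub (hm s) (hm t)
  rw [hz, zero_mul, sub_zero] at hc
  refine hc.symm.trans ?_
  split_ifs with h
  · subst h
    rw [covariance_self (h2 s).aemeasurable, (h2 s).variance_eq]
    simp
  · exact (h1.indepFun h).covariance_eq_zero (hm s) (hm t)

lemma hasLaw_train {Ω ι : Type*} [MeasurableSpace Ω] {μ : Measure Ω} [Fintype ι] {n K : ℕ}
    {w : Ω → Fin n × ι → ℝ} (fold : Fin n → Fin K) (k : Fin K)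
    (hw : HasLaw w (gaussMat (Fin n) ι) μ) :
    HasLaw (fun ω (q : {i // fold i ≠ k} × ι) => w ω (q.1.1, q.2))
      (gaussMat {i // fold i ≠ k} ι) μ :=
  hasLaw_pi_comp hw (f := fun q : {i // fold i ≠ k} × ι => ((q.1.1, q.2) : Fin n × ι))
    fun q q' h => by
      obtain ⟨h1, h2⟩ := Prod.mk.inj h
      exact Prod.ext (Subtype.ext h1) h2

lemma measurable_trainPart {ι : Type*} {n K : ℕ} (fold : Fin n → Fin K) (k : Fin K)
    (i : {i // fold i ≠ k}) (j : ι) :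
    Measurable fun x : Fin n × ι → ℝ => trainPart fold k (toMat x) i j :=
  measurable_pi_apply (i.1, j)

lemma measurable_testPart {ι : Type*} {n K : ℕ} (fold : Fin n → Fin K) (k : Fin K)
    (i : {i // fold i = k}) (j : ι) :
    Measurable fun x : Fin n × ι → ℝ => testPart fold k (toMat x) i j :=
  measurable_pi_apply (i.1, j)

variable {Ω : Type*} [MeasurableSpace Ω] {μ : Measure Ω} {n K d : ℕ}
  {ι τ : Type*} [Fintype ι] [DecidableEq ι] [Fintype τ]
  {w : Ω → Fin n × ι → ℝ} {N : Ω → Matrix (Fin n) τ ℝ} {c : ℝ}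

lemma measurable_gram_inv {ν : Type*} [Fintype ν] {β : Type*} [MeasurableSpace β]
    {A : β → Matrix ν ι ℝ} (hA : ∀ i j, Measurable fun x => A x i j) (i j : ι) :
    Measurable fun x => ((A x)ᵀ * A x)⁻¹ i j :=
  measurable_inv_apply (measurable_mul_apply (fun i j => hA j i) hA) i j

lemma measurable_gram_inv_mul {ν : Type*} [Fintype ν] {β : Type*} [MeasurableSpace β]
    {A : β → Matrix ν ι ℝ} (hA : ∀ i j, Measurable fun x => A x i j) (i : ι) (j : ν) :
    Measurable fun x => (((A x)ᵀ * A x)⁻¹ * (A x)ᵀ) i j :=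
  measurable_mul_apply (measurable_gram_inv hA) (fun i j => hA j i) i j

lemma measurable_det_gram {ν : Type*} [Fintype ν] :
    Measurable fun x : ν × ι → ℝ => ((toMat x)ᵀ * toMat x).det :=
  measurable_det (measurable_mul_apply (fun i j => measurable_toMat j i) measurable_toMat)

lemma measurable_olsSel {n K : ℕ} (fold : Fin n → Fin K) (k : Fin K) (i : ι) (j : Fin n) :
    Measurable fun x : Fin n × ι → ℝ => olsSel fold k (toMat x) i j :=
  measurable_mul_apply (B := fun _ => trainSel fold k)
    (measurable_gram_inv_mul (measurable_trainPart fold k)) (fun _ _ => measurable_const) i j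

lemma measurable_cvSel {n K : ℕ} (fold : Fin n → Fin K) (k : Fin K) (i : {i // fold i = k})
    (j : Fin n) : Measurable fun x : Fin n × ι → ℝ => cvSel fold k (toMat x) i j :=
  measurable_const.sub
    (measurable_mul_apply (measurable_testPart fold k) (measurable_olsSel fold k) i j)

lemma ae_det_ne_zero {ν : Type*} [Fintype ν] {w : Ω → ν × ι → ℝ}
    (hw : HasLaw w (gaussMat ν ι) μ) (h : Fintype.card ι + 1 < Fintype.card ν) :
    ∀ᵐ ω ∂μ, ((toMat (w ω))ᵀ * toMat (w ω)).det ≠ 0 :=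
  (hw.ae_iff (p := fun x => ((toMat x)ᵀ * toMat x).det ≠ 0)
    (measurableSet_setOfPred.1 (measurable_det_gram (measurableSet_singleton 0).compl))).2
    (inverse_wishart h).1

lemma integral_trace_gram_inv {ν : Type*} [Fintype ν] {w : Ω → ν × ι → ℝ}
    (hw : HasLaw w (gaussMat ν ι) μ) (h : Fintype.card ι + 1 < Fintype.card ν) :
    Integrable (fun ω => (((toMat (w ω))ᵀ * toMat (w ω))⁻¹).trace) μ ∧
    ∫ ω, (((toMat (w ω))ᵀ * toMat (w ω))⁻¹).trace ∂μ =
      (Fintype.card ι : ℝ) / ((Fintype.card ν : ℝ) - Fintype.card ι - 1) := by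
  obtain ⟨-, h2, h3⟩ := inverse_wishart (ν := ν) (ι := ι) h
  constructor
  · rw [← hw.map_eq] at h2
    exact h2.comp_aemeasurable hw.aemeasurable
  · rw [← h3]
    exact hw.integral_comp h2.1

variable {fold : Fin n → Fin K} {k : Fin K}

lemma ae_det_train_ne_zero (hfold : Fintype.card {i // fold i = k} = d)
    (hw : HasLaw w (gaussMat (Fin n) ι) μ) (h : d + Fintype.card ι + 1 < n) :
    ∀ᵐ ω ∂μ, ((trainPart fold k (toMat (w ω)))ᵀ * trainPart fold k (toMat (w ω))).det ≠ 0 := by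
  simp only [trainPart_toMat]
  exact ae_det_ne_zero (hasLaw_train fold k hw) (by rw [card_train fold k hfold]; omega)

lemma integral_trace_train (hfold : Fintype.card {i // fold i = k} = d)
    (hw : HasLaw w (gaussMat (Fin n) ι) μ) (h : d + Fintype.card ι + 1 < n) :
    Integrable (fun ω =>
      (((trainPart fold k (toMat (w ω)))ᵀ * trainPart fold k (toMat (w ω)))⁻¹).trace) μ ∧
    ∫ ω, (((trainPart fold k (toMat (w ω)))ᵀ * trainPart fold k (toMat (w ω)))⁻¹).trace ∂μ =
      (Fintype.card ι : ℝ) / ((n : ℝ) - d - Fintype.card ι - 1) := by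
  have := integral_trace_gram_inv (hasLaw_train fold k hw)
    (by rw [card_train fold k hfold]; omega)
  rw [card_train fold k hfold, Nat.cast_sub (by omega)] at this
  simp only [trainPart_toMat]
  exact this

lemma frobSq_olsSel_ae_eq (hfold : Fintype.card {i // fold i = k} = d)
    (hw : HasLaw w (gaussMat (Fin n) ι) μ) (h : d + Fintype.card ι + 1 < n) :
    (fun ω => frobSq (olsSel fold k (toMat (w ω)))) =ᵐ[μ] fun ω =>
      (((trainPart fold k (toMat (w ω)))ᵀ * trainPart fold k (toMat (w ω)))⁻¹).trace := by
  filter_upwards [ae_det_train_ne_zero hfold hw h] with ω hω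
  exact frobSq_gram_inv_mul hω (trainSel_mul_transpose fold k)

lemma integral_frobSq_fit [IsProbabilityMeasure μ]
    (hw : HasLaw w (gaussMat (Fin n) ι) μ) (h : Fintype.card ι + 1 < n)
    (hN : ∀ l t, MemLp (fun ω => N ω l t) 2 μ)
    (hI : IndepFun w (fun ω => (fun l t => N ω l t : Fin n → τ → ℝ)) μ)
    (hc : ∀ l l', ∫ ω, (N ω * (N ω)ᵀ) l l' ∂μ = (c • (1 : Matrix (Fin n) (Fin n) ℝ)) l l') :
    Integrable (fun ω => frobSq (toMat (w ω) * ols (toMat (w ω)) (N ω))) μ ∧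
      ∫ ω, frobSq (toMat (w ω) * ols (toMat (w ω)) (N ω)) ∂μ = c * Fintype.card ι := by
  have hae : (fun ω => frobSq (hat (toMat (w ω)))) =ᵐ[μ] fun _ => (Fintype.card ι : ℝ) := by
    filter_upwards [ae_det_ne_zero hw (by simpa using h)] with ω hω using frobSq_hat hω
  have key := integral_frobSq_mul (φ := fun x => hat (toMat x)) hw.aemeasurable
    (measurable_mul_apply measurable_toMat (measurable_gram_inv_mul measurable_toMat))
    ((integrable_const _).congr hae.symm) hN hI hc
  rw [integral_congr_ae hae] at key
  simpa [hat, ols, Matrix.mul_assoc] using key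

lemma integral_frobSq_residual [IsProbabilityMeasure μ]
    (hw : HasLaw w (gaussMat (Fin n) ι) μ) (h : Fintype.card ι + 1 < n)
    (hN : ∀ l t, MemLp (fun ω => N ω l t) 2 μ)
    (hI : IndepFun w (fun ω => (fun l t => N ω l t : Fin n → τ → ℝ)) μ)
    (hc : ∀ l l', ∫ ω, (N ω * (N ω)ᵀ) l l' ∂μ = (c • (1 : Matrix (Fin n) (Fin n) ℝ)) l l') :
    Integrable (fun ω => frobSq (N ω - toMat (w ω) * ols (toMat (w ω)) (N ω))) μ ∧
      ∫ ω, frobSq (N ω - toMat (w ω) * ols (toMat (w ω)) (N ω)) ∂μ =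
        c * ((n : ℝ) - Fintype.card ι) := by
  have hae : (fun ω => frobSq (1 - hat (toMat (w ω)))) =ᵐ[μ]
      fun _ => (n : ℝ) - (Fintype.card ι : ℝ) := by
    filter_upwards [ae_det_ne_zero hw (by simpa using h)] with ω hω
    rw [frobSq_one_sub_hat hω, Fintype.card_fin]
  have key := integral_frobSq_mul (φ := fun x => 1 - hat (toMat x)) hw.aemeasurable
    (fun a l => measurable_const.sub (measurable_mul_apply measurable_toMat
      (measurable_gram_inv_mul measurable_toMat) a l))
    ((integrable_const _).congr hae.symm) hN hI hc
  rw [integral_congr_ae hae] at key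
  simpa [hat, ols, Matrix.mul_assoc, Matrix.sub_mul] using key

lemma integral_frobSq_ols_train (hfold : Fintype.card {i // fold i = k} = d)
    (hw : HasLaw w (gaussMat (Fin n) ι) μ) (h : d + Fintype.card ι + 1 < n)
    (hN : ∀ l t, MemLp (fun ω => N ω l t) 2 μ)
    (hI : IndepFun w (fun ω => (fun l t => N ω l t : Fin n → τ → ℝ)) μ)
    (hc : ∀ l l', ∫ ω, (N ω * (N ω)ᵀ) l l' ∂μ = (c • (1 : Matrix (Fin n) (Fin n) ℝ)) l l') :
    Integrable (fun ω =>
      frobSq (ols (trainPart fold k (toMat (w ω))) (trainPart fold k (N ω)))) μ ∧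
    ∫ ω, frobSq (ols (trainPart fold k (toMat (w ω))) (trainPart fold k (N ω))) ∂μ =
      c * ((Fintype.card ι : ℝ) / ((n : ℝ) - d - Fintype.card ι - 1)) := by
  obtain ⟨t1, t2⟩ := integral_trace_train hfold hw h
  have hae := frobSq_olsSel_ae_eq hfold hw h
  have key := integral_frobSq_mul (φ := fun x => olsSel fold k (toMat x)) hw.aemeasurable
    (measurable_olsSel fold k) (t1.congr hae.symm) hN hI hc
  rw [integral_congr_ae hae, t2] at key
  simpa only [olsSel_mul] using key

lemma integral_ols_train_eq_zero [IsProbabilityMeasure μ] {τ : Type*}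
    {N : Ω → Matrix (Fin n) τ ℝ}
    (hfold : Fintype.card {i // fold i = k} = d)
    (hw : HasLaw w (gaussMat (Fin n) ι) μ) (h : d + Fintype.card ι + 1 < n)
    (hN : ∀ l t, Integrable (fun ω => N ω l t) μ)
    (hI : IndepFun w (fun ω => (fun l t => N ω l t : Fin n → τ → ℝ)) μ)
    (hc : ∀ l t, ∫ ω, N ω l t ∂μ = 0) (a : ι) (t : τ) :
    Integrable (fun ω => ols (trainPart fold k (toMat (w ω))) (trainPart fold k (N ω)) a t) μ ∧
    ∫ ω, ols (trainPart fold k (toMat (w ω))) (trainPart fold k (N ω)) a t ∂μ = 0 := by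
  have key := integral_mul_apply_eq_zero (φ := fun x => olsSel fold k (toMat x))
    (measurable_olsSel fold k)
    (fun a l => (memLp_apply_of_integrable_frobSq (fun a l =>
        ((measurable_olsSel fold k a l).comp_aemeasurable hw.aemeasurable).aestronglyMeasurable)
      ((integral_trace_train hfold hw h).1.congr
        (frobSq_olsSel_ae_eq hfold hw h).symm) a l).integrable one_le_two) hN hI hc a t
  simpa only [olsSel_mul] using key

/-- The transposed test rows play the part of the noise: they are independent of the training rows,
and their second moment is `d I`, one identity for each of the `d` test rows. What remains is the
trace of an inverse Wishart matrix. -/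
lemma integral_frobSq_leverage (hfold : Fintype.card {i // fold i = k} = d)
    (hw : HasLaw w (gaussMat (Fin n) ι) μ) (h : d + Fintype.card ι + 1 < n) :
    Integrable (fun ω => frobSq (trainPart fold k (toMat (w ω)) *
      ((trainPart fold k (toMat (w ω)))ᵀ * trainPart fold k (toMat (w ω)))⁻¹ *
        (testPart fold k (toMat (w ω)))ᵀ)) μ ∧
    ∫ ω, frobSq (trainPart fold k (toMat (w ω)) *
      ((trainPart fold k (toMat (w ω)))ᵀ * trainPart fold k (toMat (w ω)))⁻¹ *
        (testPart fold k (toMat (w ω)))ᵀ) ∂μ =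
      d * ((Fintype.card ι : ℝ) / ((n : ℝ) - d - Fintype.card ι - 1)) := by
  classical
  obtain ⟨t1, t2⟩ := integral_trace_train hfold hw h
  have htr := hasLaw_train fold k hw
  have hae : (fun ω => frobSq (trainPart fold k (toMat (w ω)) *
      ((trainPart fold k (toMat (w ω)))ᵀ * trainPart fold k (toMat (w ω)))⁻¹)) =ᵐ[μ] fun ω =>
      (((trainPart fold k (toMat (w ω)))ᵀ * trainPart fold k (toMat (w ω)))⁻¹).trace := by
    filter_upwards [ae_det_train_ne_zero hfold hw h] with ω hω
    -- The matrix is the transpose of `(Wᵀ W)⁻¹ Wᵀ` for the training rows, whose squared norm is the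
    -- trace of the inverse Gram matrix.
    have := frobSq_gram_inv_mul hω (P := 1) (by rw [Matrix.transpose_one, Matrix.one_mul])
    rw [← this, ← frobSq_transpose]
    simp only [Matrix.transpose_mul, gram_inv_transpose, Matrix.mul_one]
  have key := integral_frobSq_mul (c := (d : ℝ))
    (w := fun ω (q : {i // fold i ≠ k} × ι) => w ω (q.1.1, q.2))
    (φ := fun x => toMat x * ((toMat x)ᵀ * toMat x)⁻¹)
    (N := fun ω => (testPart fold k (toMat (w ω)))ᵀ) htr.aemeasurable
    (measurable_mul_apply measurable_toMat (measurable_gram_inv measurable_toMat))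
    (t1.congr hae.symm) (fun l t => (integral_mul_of_hasLaw_pi hw (t.1, l) (t.1, l)).1)
    ((indepFun_pi_comp hw (f := fun q : {i // fold i ≠ k} × ι => ((q.1.1, q.2) : Fin n × ι))
      (g := fun q : ι × {i // fold i = k} => ((q.2.1, q.1) : Fin n × ι)) (fun s s' hs =>
        s.1.2 (by rw [(Prod.mk.inj hs).1]; exact s'.2.2))).comp
      (φ := id) (ψ := fun x : ι × {i // fold i = k} → ℝ => fun l t => x (l, t)) measurable_id
      (measurable_pi_lambda _ fun l => measurable_pi_lambda _ fun t => measurable_pi_apply _))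
    (fun l l' => by
      simp only [Matrix.mul_apply, Matrix.transpose_apply]
      have e : ∀ t : {i // fold i = k}, _ := fun t => integral_mul_of_hasLaw_pi hw (t.1, l) (t.1, l')
      have e' : ∀ t : {i // fold i = k}, _ := fun t =>
        integral_mul_of_hasLaw_pi hw (t.1, l') (t.1, l')
      have := integral_finsetSum (μ := μ) Finset.univ
        (f := fun (t : {i // fold i = k}) ω => w ω (t.1, l) * w ω (t.1, l'))
        fun t _ => (e t).1.integrable_mul (e' t).1
      refine this.trans ?_
      simp only [(e _).2]
      by_cases hl : l = l' <;> simp [hl, hfold])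
  have e2 := integral_congr_ae hae
  rw [t2] at e2
  refine ⟨key.1, key.2.trans ?_⟩
  rw [← e2]
  rfl

lemma integral_frobSq_cvResidual [IsProbabilityMeasure μ]
    (hfold : Fintype.card {i // fold i = k} = d)
    (hw : HasLaw w (gaussMat (Fin n) ι) μ) (h : d + Fintype.card ι + 1 < n)
    (hN : ∀ l t, MemLp (fun ω => N ω l t) 2 μ)
    (hI : IndepFun w (fun ω => (fun l t => N ω l t : Fin n → τ → ℝ)) μ)
    (hc : ∀ l l', ∫ ω, (N ω * (N ω)ᵀ) l l' ∂μ = (c • (1 : Matrix (Fin n) (Fin n) ℝ)) l l') :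
    Integrable (fun ω => frobSq (testPart fold k (N ω) - testPart fold k (toMat (w ω)) *
      ols (trainPart fold k (toMat (w ω))) (trainPart fold k (N ω)))) μ ∧
    ∫ ω, frobSq (testPart fold k (N ω) - testPart fold k (toMat (w ω)) *
      ols (trainPart fold k (toMat (w ω))) (trainPart fold k (N ω))) ∂μ =
      c * (d + d * ((Fintype.card ι : ℝ) / ((n : ℝ) - d - Fintype.card ι - 1))) := by
  obtain ⟨t1, t2⟩ := integral_frobSq_leverage hfold hw h
  have hae : (fun ω => frobSq (cvSel fold k (toMat (w ω)))) =ᵐ[μ] fun ω =>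
      (d : ℝ) + frobSq (trainPart fold k (toMat (w ω)) *
      ((trainPart fold k (toMat (w ω)))ᵀ * trainPart fold k (toMat (w ω)))⁻¹ *
        (testPart fold k (toMat (w ω)))ᵀ) := by
    filter_upwards with ω
    rw [frobSq_cvSel, hfold]
  have key := integral_frobSq_mul (φ := fun x => cvSel fold k (toMat x)) hw.aemeasurable
    (measurable_cvSel fold k) (((integrable_const _).add t1).congr hae.symm) hN hI hc
  rw [integral_congr_ae hae, integral_add (integrable_const _) t1, t2] at key
  simpa only [cvSel_mul, integral_const, probReal_univ, one_smul] using key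

end StandardDesign

/-! ### The cross-validation identity for a general design -/

/-- A signal in the column space is recovered exactly, so only the noise `N` leaves an error in the
coefficients. -/
lemma ols_mul_add {ν ι τ : Type*} [Fintype ν] [Fintype ι] [DecidableEq ι] {W : Matrix ν ι ℝ}
    (hW : (Wᵀ * W).det ≠ 0) {T : Matrix ι ι ℝ} (hT : IsUnit T.det) (D : Matrix ι τ ℝ)
    (N : Matrix ν τ ℝ) : ols (W * T) (W * T * D + N) = D + T⁻¹ * ols W N := by
  have hdet : ((W * T)ᵀ * (W * T)).det ≠ 0 := by
    rw [Matrix.transpose_mul, Matrix.mul_assoc, ← Matrix.mul_assoc Wᵀ, Matrix.det_mul,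
      Matrix.det_mul, Matrix.det_transpose]
    exact mul_ne_zero hT.ne_zero (mul_ne_zero hW hT.ne_zero)
  rw [ols_add, ols_mul_self hdet, ols_mul_right W hT]

lemma frobSq_sqrt_mul {ι τ : Type*} [Fintype ι] [DecidableEq ι] [Fintype τ] {M : Matrix ι ι ℝ}
    (hM : M.PosSemidef) (V : Matrix ι τ ℝ) :
    frobSq (CFC.sqrt M * V) = (Vᵀ * M * V).trace := by
  have h1 : (CFC.sqrt M)ᵀ = CFC.sqrt M := by
    have := (CFC.sqrt_nonneg M).isSelfAdjoint.star_eq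
    rwa [Matrix.star_eq_conjTranspose, Matrix.conjTranspose_eq_transpose_of_trivial] at this
  rw [frobSq_eq_trace', Matrix.transpose_mul, h1, Matrix.mul_assoc, ← Matrix.mul_assoc _ _ V,
    CFC.sqrt_mul_sqrt_self M hM.nonneg, Matrix.mul_assoc]

lemma exists_symm_sqrt {ι : Type*} [Fintype ι] [DecidableEq ι] {S : Matrix ι ι ℝ}
    (hS : S.PosDef) : ∃ T : Matrix ι ι ℝ, Tᵀ = T ∧ T * T = S ∧ IsUnit T.det := by
  have h2 := CFC.sqrt_mul_sqrt_self S hS.posSemidef.nonneg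
  refine ⟨CFC.sqrt S, ?_, h2, ?_⟩
  · have := (CFC.sqrt_nonneg S).isSelfAdjoint.star_eq
    rwa [Matrix.star_eq_conjTranspose, Matrix.conjTranspose_eq_transpose_of_trivial] at this
  · rw [isUnit_iff_ne_zero]
    intro h
    have := hS.det_pos
    rw [← h2, Matrix.det_mul, h] at this
    simp at this

/-- With `K = n / d` the denominator is `(n - d - r - 1) / d`, and the numerator exceeds it by `n /
d`. -/
lemma cv_factor_eq {n d K r : ℝ} (hd : d ≠ 0) (hn : n = d * K) (hn0 : n ≠ 0)
    (h : n - d - r - 1 ≠ 0) :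
    ((2 - (r + 1) / n) * K - 1) / ((1 - (r + 1) / n) * K - 1) = 1 + n / (n - d - r - 1) := by
  have hK : K = n / d := by rw [hn]; field_simp
  have h1 : (1 - (r + 1) / n) * K - 1 = (n - d - r - 1) / d := by
    rw [hK]; field_simp; ring
  have h2 : (2 - (r + 1) / n) * K - 1 = ((n - d - r - 1) + n) / d := by
    rw [hK]; field_simp; ring
  rw [h1, h2]
  field_simp

lemma card_eq_mul {n K d : ℕ} {fold : Fin n → Fin K}
    (hfold : ∀ k, Fintype.card {i // fold i = k} = d) : n = d * K := by
  have h := Finset.card_eq_sum_card_fiberwise (f := fold) (s := Finset.univ) (t := Finset.univ)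
    (fun _ _ => Finset.mem_coe.2 (Finset.mem_univ _))
  simp only [← Fintype.card_subtype, hfold] at h
  simpa [mul_comm] using h

section Identity

variable {Ω : Type*} [MeasurableSpace Ω] {μ : Measure Ω} {n p m d K : ℕ}
  {Sigma : Matrix (Fin p) (Fin p) ℝ} {σ : ℝ} {X : Ω → Matrix (Fin n) (Fin p) ℝ}
  {E : Ω → Matrix (Fin n) (Fin m) ℝ} {ι : Type*}

lemma GaussianModel.integral_mul_transpose (h : GaussianModel μ Sigma σ X E)
    (hS : Sigma.PosSemidef) (L : Matrix (Fin p) (Fin m) ℝ) (l l' : Fin n) :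
    ∫ ω, (X ω * L * (X ω * L)ᵀ) l l' ∂μ =
      ((Lᵀ * Sigma * L).trace • (1 : Matrix (Fin n) (Fin n) ℝ)) l l' := by
  simp only [Matrix.mul_apply (M := X _ * L), Matrix.transpose_apply]
  have hi : ∀ t, Integrable (fun ω => (X ω * L) l t * (X ω * L) l' t) μ := fun t =>
    (h.memLp_mul L l t).integrable_mul (h.memLp_mul L l' t)
  rw [integral_finsetSum _ fun t _ => hi t]
  simp only [h.integral_mul_mul hS]
  by_cases hl : l = l' <;> simp [hl, Matrix.trace]

/-- `X L` is independent of `X A` because it is uncorrelated with it, and `E` is independent of the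
pair because it is independent of `X`. Hence `X A` is independent of `(X L, E)` jointly, and so of
their sum. -/
lemma GaussianModel.indepFun_noise [Fintype ι] [IsProbabilityMeasure μ]
    (h : GaussianModel μ Sigma σ X E)
    (hS : Sigma.PosSemidef) {A : Matrix (Fin p) ι ℝ} {L : Matrix (Fin p) (Fin m) ℝ}
    (hAL : Aᵀ * Sigma * L = 0) :
    IndepFun (fun ω (q : Fin n × ι) => (X ω * A) q.1 q.2)
        (fun ω => (fun l t => (X ω * L) l t : Fin n → Fin m → ℝ)) μ ∧
      IndepFun (fun ω (q : Fin n × ι) => (X ω * A) q.1 q.2)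
        (fun ω => (fun l t => (X ω * L + E ω) l t : Fin n → Fin m → ℝ)) μ := by
  have h1 := h.indepFun_mul hS hAL
  have hw := (h.hasGaussianLaw_mul A).aemeasurable
  have hF := (h.hasGaussianLaw_mul L).aemeasurable
  have hE : AEMeasurable (fun ω => (fun i j => E ω i j : Fin n → Fin m → ℝ)) μ :=
    aemeasurable_pi_lambda _ fun i => aemeasurable_pi_lambda _ fun j =>
      (h.noise_memLp i j).1.aemeasurable
  have hA := (mulRightCLM n A).continuous.measurable
  have hL := (mulRightCLM n L).continuous.measurable
  have h2 := h.indep.comp (hA.prodMk hL) measurable_id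
  have e : (fun x : Fin n → Fin p → ℝ => (mulRightCLM n A x, mulRightCLM n L x)) ∘
      (fun ω => (fun i j => X ω i j : Fin n → Fin p → ℝ)) =
      fun ω => ((fun q : Fin n × ι => (X ω * A) q.1 q.2),
        fun q : Fin n × Fin m => (X ω * L) q.1 q.2) := by
    ext ω
    · exact mulRightCLM_apply A (X ω) _
    · exact mulRightCLM_apply L (X ω) _
  rw [e] at h2
  have h3 := indepFun_prodMk_of_indepFun hw hF hE h1 h2
  constructor
  · exact h1.comp (φ := id) (ψ := fun x : Fin n × Fin m → ℝ => fun l t => x (l, t)) measurable_id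
      (measurable_pi_lambda _ fun l => measurable_pi_lambda _ fun t => measurable_pi_apply _)
  · exact h3.comp (φ := id)
      (ψ := fun x : (Fin n × Fin m → ℝ) × (Fin n → Fin m → ℝ) => fun l t => x.1 (l, t) + x.2 l t)
      measurable_id
      (measurable_pi_lambda _ fun l => measurable_pi_lambda _ fun t =>
        ((measurable_pi_apply (l, t)).comp measurable_fst).add
          ((measurable_pi_apply t).comp ((measurable_pi_apply l).comp measurable_snd)))

/-- The mixed terms vanish because `X L` is centered and independent of `E`; the noise itself need
not be centered. -/
lemma GaussianModel.noise_second_moment_add [IsProbabilityMeasure μ]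
    (h : GaussianModel μ Sigma σ X E) (hS : Sigma.PosSemidef) (L : Matrix (Fin p) (Fin m) ℝ)
    (l l' : Fin n) :
    ∫ ω, ((X ω * L + E ω) * (X ω * L + E ω)ᵀ) l l' ∂μ =
      (((Lᵀ * Sigma * L).trace + m * σ ^ 2) • (1 : Matrix (Fin n) (Fin n) ℝ)) l l' := by
  have hF := h.memLp_mul L
  have hE := h.noise_memLp
  have hind : ∀ l l' t, IndepFun (fun ω => (X ω * L) l t) (fun ω => E ω l' t) μ := by
    intro l l' t
    have h2 := h.indep.comp (φ := fun x => mulRightCLM n L x (l, t))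
      (ψ := fun x : Fin n → Fin m → ℝ => x l' t)
      ((measurable_pi_apply _).comp (mulRightCLM n L).continuous.measurable)
      (by fun_prop)
    have e : (fun x : Fin n → Fin p → ℝ => mulRightCLM n L x (l, t)) ∘
        (fun ω => (fun i j => X ω i j : Fin n → Fin p → ℝ)) = fun ω => (X ω * L) l t := by
      ext ω; exact mulRightCLM_apply L (X ω) _
    rwa [e] at h2
  have hz : ∀ l l' t, ∫ ω, (X ω * L) l t * E ω l' t ∂μ = 0 := fun l l' t => by
    rw [(hind l l' t).integral_fun_mul_eq_mul_integral (hF l t).1 (hE l' t).1,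
      h.integral_mul_eq_zero, zero_mul]
  have e : ∀ ω, ((X ω * L + E ω) * (X ω * L + E ω)ᵀ) l l' =
      (X ω * L * (X ω * L)ᵀ) l l' + ∑ t, (X ω * L) l t * E ω l' t +
        ∑ t, (X ω * L) l' t * E ω l t + (E ω * (E ω)ᵀ) l l' := by
    intro ω
    simp only [Matrix.mul_apply (M := X ω * L + E ω), Matrix.mul_apply (M := X ω * L) (N := (_)ᵀ),
      Matrix.mul_apply (M := E ω),
      ← Finset.sum_add_distrib, Matrix.transpose_apply, Matrix.add_apply]
    exact Finset.sum_congr rfl fun t _ => by ring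
  have i1 : Integrable (fun ω => (X ω * L * (X ω * L)ᵀ) l l') μ := by
    simp only [Matrix.mul_apply (M := X _ * L), Matrix.transpose_apply]
    exact integrable_finsetSum _ fun t _ => (hF l t).integrable_mul (hF l' t)
  have i2 : ∀ l l', Integrable (fun ω => ∑ t, (X ω * L) l t * E ω l' t) μ := fun l l' =>
    integrable_finsetSum _ fun t _ => (hF l t).integrable_mul (hE l' t)
  have i4 : Integrable (fun ω => (E ω * (E ω)ᵀ) l l') μ := by
    simp only [Matrix.mul_apply, Matrix.transpose_apply]
    exact integrable_finsetSum _ fun t _ => (hE l t).integrable_mul (hE l' t)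
  simp only [e]
  have hi : ∀ l l' t, Integrable (fun ω => (X ω * L) l t * E ω l' t) μ := fun l l' t =>
    (hF l t).integrable_mul (hE l' t)
  rw [integral_add (by exact (i1.add (i2 l l')).add (i2 l' l)) i4,
    integral_add (by exact i1.add (i2 l l')) (i2 l' l), integral_add i1 (i2 l l'),
    integral_finsetSum _ fun t _ => hi l l' t, integral_finsetSum _ fun t _ => hi l' l t,
    h.noise_second_moment, h.integral_mul_transpose hS]
  simp only [hz, Finset.sum_const_zero, add_zero]
  simp only [Matrix.smul_apply, smul_eq_mul]
  ring

/-- The cross-validation identity when `B* = O C + G`, where the part `O C` of the signal lies in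
the column space of the pattern `O`. -/
theorem cv_identity [IsProbabilityMeasure μ] {fold : Fin n → Fin K}
    (hfold : ∀ k, Fintype.card {i // fold i = k} = d) (hSigma : Sigma.PosDef)
    (h : GaussianModel μ Sigma σ X E) [Fintype ι] [DecidableEq ι] {O : Matrix (Fin p) ι ℝ}
    (hO : (Oᵀ * Sigma * O).PosDef) (C : Matrix ι (Fin m) ℝ) (G : Matrix (Fin p) (Fin m) ℝ)
    (hd : d + Fintype.card ι + 1 < n) (k : Fin K) :
    Integrable (fun ω => cvErr fold (X ω) (X ω * (O * C + G) + E ω) O) μ ∧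
    Integrable (fun ω => trnErr (X ω) (X ω * (O * C + G) + E ω) O) μ ∧
    (∀ i j, Integrable
      (fun ω => ols (trainPart fold k (X ω) * O) (trainPart fold k (X ω) * G) i j) μ) ∧
    Integrable (fun ω => frobSq (X ω * O * (ols (X ω * O) (X ω * G) -
      expect μ fun ω' => ols (trainPart fold k (X ω') * O) (trainPart fold k (X ω') * G)))) μ ∧
    Integrable (fun ω => frobSq (CFC.sqrt (Oᵀ * ((n : ℝ) • Sigma) * O) *
      (ols (trainPart fold k (X ω) * O) (trainPart fold k (X ω) * G) -
      expect μ fun ω' => ols (trainPart fold k (X ω') * O) (trainPart fold k (X ω') * G)))) μ ∧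
    ∫ ω, cvErr fold (X ω) (X ω * (O * C + G) + E ω) O ∂μ =
      ∫ ω, trnErr (X ω) (X ω * (O * C + G) + E ω) O ∂μ +
      ((2 - ((Fintype.card ι : ℝ) + 1) / n) * K - 1) /
        ((1 - ((Fintype.card ι : ℝ) + 1) / n) * K - 1) * (m * Fintype.card ι * σ ^ 2) +
      ∫ ω, frobSq (X ω * O * (ols (X ω * O) (X ω * G) -
        expect μ fun ω' => ols (trainPart fold k (X ω') * O) (trainPart fold k (X ω') * G))) ∂μ +
      ∫ ω, frobSq (CFC.sqrt (Oᵀ * ((n : ℝ) • Sigma) * O) *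
        (ols (trainPart fold k (X ω) * O) (trainPart fold k (X ω) * G) -
        expect μ fun ω' =>
          ols (trainPart fold k (X ω') * O) (trainPart fold k (X ω') * G))) ∂μ := by
  set S := Oᵀ * Sigma * O with hSdef
  -- With `T = S^(1/2)`, the matrix `X O T⁻¹` has independent standard Gaussian entries.
  obtain ⟨T, hTt, hTT, hTu⟩ := exists_symm_sqrt hO
  have hSu : IsUnit S.det := hO.det_pos.ne'.isUnit
  have hTi : T * T⁻¹ = 1 := Matrix.mul_nonsing_inv _ hTu
  have hTi' : T⁻¹ * T = 1 := Matrix.nonsing_inv_mul _ hTu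
  have hTit : (T⁻¹)ᵀ = T⁻¹ := by rw [Matrix.transpose_nonsing_inv, hTt]
  have hA : (O * T⁻¹)ᵀ * Sigma * (O * T⁻¹) = 1 := by
    calc (O * T⁻¹)ᵀ * Sigma * (O * T⁻¹) = T⁻¹ * S * T⁻¹ := by
          rw [Matrix.transpose_mul, hTit, hSdef]; simp only [Matrix.mul_assoc]
      _ = (T⁻¹ * T) * (T * T⁻¹) := by rw [← hTT]; simp only [Matrix.mul_assoc]
      _ = 1 := by rw [hTi, hTi', Matrix.one_mul]
  -- The population regression coefficients of `X G` on `X O`, chosen so that the remainder `X L` is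
  -- uncorrelated with `X O`.
  set Γ := S⁻¹ * Oᵀ * Sigma * G with hΓ
  set L := G - O * Γ with hL
  have hAL : (O * T⁻¹)ᵀ * Sigma * L = 0 := by
    have : Oᵀ * Sigma * L = 0 := by
      rw [hL, Matrix.mul_sub, ← Matrix.mul_assoc _ O, ← hSdef, hΓ, Matrix.mul_assoc S⁻¹,
        Matrix.mul_assoc S⁻¹, ← Matrix.mul_assoc S, Matrix.mul_nonsing_inv _ hSu, Matrix.one_mul,
        sub_self]
    rw [Matrix.transpose_mul, Matrix.mul_assoc, Matrix.mul_assoc, ← Matrix.mul_assoc Oᵀ, this,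
      Matrix.mul_zero]
  set w : Ω → Fin n × ι → ℝ := fun ω q => (X ω * (O * T⁻¹)) q.1 q.2 with hwdef
  have hSp := hSigma.posSemidef
  have hw : HasLaw w (gaussMat (Fin n) ι) μ := h.hasLaw_mul hSp hA
  have hXO : ∀ ω, X ω * O = toMat (w ω) * T := fun ω => by
    have : toMat (w ω) = X ω * (O * T⁻¹) := rfl
    rw [this, Matrix.mul_assoc, Matrix.mul_assoc O, hTi', Matrix.mul_one]
  have hXG : ∀ ω, X ω * G = toMat (w ω) * T * Γ + X ω * L := fun ω => by
    rw [← hXO, hL, Matrix.mul_sub, Matrix.mul_assoc]; abel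
  obtain ⟨hIF, hIN⟩ := h.indepFun_noise hSp hAL
  have hFm := h.memLp_mul L
  have hNm : ∀ l t, MemLp (fun ω => (X ω * L + E ω) l t) 2 μ := fun l t =>
    (hFm l t).add (h.noise_memLp l t)
  have hFc := h.integral_mul_transpose hSp L
  have hNc := h.noise_second_moment_add hSp L
  set c₁ := (Lᵀ * Sigma * L).trace with hc₁
  have hr : Fintype.card ι + 1 < n := by omega
  have hdet := ae_det_ne_zero hw (by simpa using hr)
  have hdetk := fun k => ae_det_train_ne_zero (hfold k) hw hd
  have hmul : ∀ (k : Fin K) ω, trainPart fold k (X ω) * O = trainPart fold k (toMat (w ω)) * T :=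
    fun k ω => congrArg (trainPart fold k) (hXO ω)
  have hmul' : ∀ (k : Fin K) ω, testPart fold k (X ω) * O = testPart fold k (toMat (w ω)) * T :=
    fun k ω => congrArg (testPart fold k) (hXO ω)
  have hmulG : ∀ (k : Fin K) ω, trainPart fold k (X ω) * G =
      trainPart fold k (toMat (w ω)) * T * Γ + trainPart fold k (X ω * L) :=
    fun k ω => congrArg (trainPart fold k) (hXG ω)
  -- The response as a signal in the column space of the standardized design plus noise independent
  -- of that design.
  have hY : ∀ ω, X ω * (O * C + G) + E ω = toMat (w ω) * T * (C + Γ) + (X ω * L + E ω) := fun ω => by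
    rw [Matrix.mul_add, hXG, ← Matrix.mul_assoc, hXO, Matrix.mul_add]; abel
  have hcancel : ∀ {ν : Type} (W : Matrix ν ι ℝ) (U : Matrix ι (Fin m) ℝ),
      W * T * (T⁻¹ * U) = W * U := fun W U => by
    rw [Matrix.mul_assoc, ← Matrix.mul_assoc T, hTi, Matrix.one_mul]
  -- training error
  have trn_ae : (fun ω => trnErr (X ω) (X ω * (O * C + G) + E ω) O) =ᵐ[μ] fun ω =>
      frobSq ((X ω * L + E ω) - toMat (w ω) * ols (toMat (w ω)) (X ω * L + E ω)) := by
    filter_upwards [hdet] with ω hω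
    rw [trnErr, restrictedOLS, ← Matrix.mul_assoc, hXO, hY, ols_mul_add hω hTu,
      Matrix.mul_add _ (C + Γ), hcancel]
    congr 1
    abel
  obtain ⟨trn1, trn2⟩ := integral_frobSq_residual hw hr hNm hIN hNc
  -- cross-validation error
  have cv_ae : (fun ω => cvErr fold (X ω) (X ω * (O * C + G) + E ω) O) =ᵐ[μ] fun ω =>
      ∑ k, frobSq (testPart fold k (X ω * L + E ω) - testPart fold k (toMat (w ω)) *
        ols (trainPart fold k (toMat (w ω))) (trainPart fold k (X ω * L + E ω))) := by
    filter_upwards [ae_all_iff.2 hdetk] with ω hω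
    refine Finset.sum_congr rfl fun k _ => ?_
    have e1 : trainPart fold k (X ω * (O * C + G) + E ω) =
        trainPart fold k (toMat (w ω)) * T * (C + Γ) + trainPart fold k (X ω * L + E ω) :=
      congrArg (trainPart fold k) (hY ω)
    have e2 : testPart fold k (X ω * (O * C + G) + E ω) =
        testPart fold k (toMat (w ω)) * T * (C + Γ) + testPart fold k (X ω * L + E ω) :=
      congrArg (testPart fold k) (hY ω)
    rw [restrictedOLS, ← Matrix.mul_assoc, hmul, hmul', e1, e2, ols_mul_add (hω k) hTu,
      Matrix.mul_add _ (C + Γ), hcancel]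
    congr 1
    abel
  have cvk := fun k => integral_frobSq_cvResidual (hfold k) hw hd hNm hIN hNc
  -- underfitting
  have tr_ae : ∀ᵐ ω ∂μ, ols (trainPart fold k (X ω) * O) (trainPart fold k (X ω) * G) =
      Γ + T⁻¹ * ols (trainPart fold k (toMat (w ω))) (trainPart fold k (X ω * L)) := by
    filter_upwards [hdetk k] with ω hω
    rw [hmul, hmulG, ols_mul_add hω hTu]
  have tr_zero := integral_ols_train_eq_zero (hfold k) hw hd
    (fun l t => (hFm l t).integrable one_le_two) hIF (fun l t => h.integral_mul_eq_zero L l t)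
  have tr_mul : ∀ i j, Integrable (fun ω => (T⁻¹ * ols (trainPart fold k (toMat (w ω)))
      (trainPart fold k (X ω * L))) i j) μ ∧ ∫ ω, (T⁻¹ * ols (trainPart fold k (toMat (w ω)))
      (trainPart fold k (X ω * L))) i j ∂μ = 0 := fun i j => by
    simp only [Matrix.mul_apply (M := T⁻¹)]
    refine ⟨integrable_finsetSum _ fun a _ => (tr_zero a j).1.const_mul _, ?_⟩
    rw [integral_finsetSum _ fun a _ => (tr_zero a j).1.const_mul _]
    simp only [integral_const_mul, (tr_zero _ j).2, mul_zero, Finset.sum_const_zero]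
  have coef_ae : ∀ i j, (fun ω =>
      ols (trainPart fold k (X ω) * O) (trainPart fold k (X ω) * G) i j) =ᵐ[μ] fun ω => Γ i j +
        (T⁻¹ * ols (trainPart fold k (toMat (w ω))) (trainPart fold k (X ω * L))) i j :=
      fun i j => by
    filter_upwards [tr_ae] with ω hω
    rw [hω, Matrix.add_apply]
  -- The coefficients of the independent centered remainder `X L` have mean zero, so the mean is `Γ`
  -- for every fold. Hence `U₀` does not depend on `k`.
  have hexp : (expect μ fun ω' => ols (trainPart fold k (X ω') * O) (trainPart fold k (X ω') * G))
      = Γ := by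
    ext i j
    rw [expect, Matrix.of_apply, integral_congr_ae (coef_ae i j),
      integral_add (integrable_const _) (tr_mul i j).1, (tr_mul i j).2]
    simp
  rw [hexp]
  have full_ae : (fun ω => frobSq (X ω * O * (ols (X ω * O) (X ω * G) - Γ))) =ᵐ[μ] fun ω =>
      frobSq (toMat (w ω) * ols (toMat (w ω)) (X ω * L)) := by
    filter_upwards [hdet] with ω hω
    rw [hXG, hXO, ols_mul_add hω hTu, add_sub_cancel_left, hcancel]
  obtain ⟨full1, full2⟩ := integral_frobSq_fit hw hr hFm hIF hFc
  have hnS : Oᵀ * ((n : ℝ) • Sigma) * O = (n : ℝ) • S := by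
    rw [hSdef, Matrix.mul_smul, Matrix.smul_mul]
  have hnSp : ((n : ℝ) • S).PosSemidef := hO.posSemidef.smul (Nat.cast_nonneg n)
  -- The weight `n S` undoes the standardization: `T⁻¹ S T⁻¹ = 1`, leaving the factor `n`.
  have train_ae : (fun ω => frobSq (CFC.sqrt (Oᵀ * ((n : ℝ) • Sigma) * O) *
      (ols (trainPart fold k (X ω) * O) (trainPart fold k (X ω) * G) - Γ))) =ᵐ[μ] fun ω =>
      (n : ℝ) * frobSq (ols (trainPart fold k (toMat (w ω))) (trainPart fold k (X ω * L))) := by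
    filter_upwards [tr_ae] with ω hω
    rw [hω, add_sub_cancel_left, hnS, frobSq_sqrt_mul hnSp, frobSq_eq_trace', Matrix.mul_smul,
      Matrix.smul_mul, Matrix.trace_smul, smul_eq_mul, Matrix.transpose_mul, hTit, ← hTT]
    congr 2
    generalize ols (trainPart fold k (toMat (w ω))) (trainPart fold k (X ω * L)) = U
    calc Uᵀ * T⁻¹ * (T * T) * (T⁻¹ * U) = Uᵀ * (T⁻¹ * T) * (T * T⁻¹) * U := by
          simp only [Matrix.mul_assoc]
      _ = Uᵀ * U := by rw [hTi, hTi', Matrix.mul_one, Matrix.mul_one]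
  obtain ⟨train1, train2⟩ := integral_frobSq_ols_train (hfold k) hw hd hFm hIF hFc
  refine ⟨(integrable_finsetSum _ fun k _ => (cvk k).1).congr cv_ae.symm, trn1.congr trn_ae.symm,
    fun i j => ((integrable_const _).add (tr_mul i j).1).congr (coef_ae i j).symm,
    full1.congr full_ae.symm, (train1.const_mul _).congr train_ae.symm, ?_⟩
  rw [integral_congr_ae cv_ae, integral_congr_ae trn_ae, integral_congr_ae full_ae,
    integral_congr_ae train_ae, integral_const_mul, trn2, full2, train2,
    integral_finsetSum _ fun k _ => (cvk k).1]
  simp only [(cvk _).2, Finset.sum_const, Finset.card_univ, Fintype.card_fin, nsmul_eq_mul]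
  have hnK : (n : ℝ) = d * K := by exact_mod_cast card_eq_mul hfold
  have hn0 : (n : ℝ) ≠ 0 := Nat.cast_ne_zero.2 (by omega)
  have hd0 : (d : ℝ) ≠ 0 := fun h0 => hn0 (by rw [hnK, h0, zero_mul])
  have hpos : (n : ℝ) - d - Fintype.card ι - 1 ≠ 0 := by
    have : ((d + Fintype.card ι + 1 : ℕ) : ℝ) < n := by exact_mod_cast hd
    push_cast at this
    linarith
  rw [cv_factor_eq hd0 hnK hn0 hpos]
  generalize (Fintype.card ι : ℝ) = r at *
  -- The total over the folds is rewritten so that `d K` can be replaced by `n`.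
  have e1 : (K : ℝ) * ((c₁ + m * σ ^ 2) * (d + d * (r / (n - d - r - 1)))) =
      (c₁ + m * σ ^ 2) * (d * K) * (1 + r / (n - d - r - 1)) := by ring
  rw [e1, ← hnK]
  field_simp
  ring

end Identity

/-! ### Patterns -/

lemma colsOf_eq_mul_selection {ν : Type*} {p : ℕ} (A : Matrix ν (Fin p) ℝ)
    (𝒥 : Finset (Fin p)) : colsOf A 𝒥 = A * selection 𝒥 := by
  ext i j
  rw [Matrix.mul_apply]
  simp [selection, colsOf, Matrix.one_apply]

lemma selection_transpose_mul_apply {p : ℕ} {τ : Type*} (𝒥 : Finset (Fin p))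
    (A : Matrix (Fin p) τ ℝ) : (selection 𝒥)ᵀ * A = rowsOf A 𝒥 := by
  ext i j
  rw [Matrix.mul_apply]
  simp [selection, colsOf, rowsOf, Matrix.one_apply]

lemma selection_transpose_mul {p : ℕ} (𝒥 : Finset (Fin p)) :
    (selection 𝒥)ᵀ * selection 𝒥 = 1 := by
  rw [selection_transpose_mul_apply]
  ext i j
  exact congrFun (congrFun (Matrix.submatrix_one _ Subtype.val_injective) i) j

lemma selection_mul_apply {p : ℕ} {τ : Type*} (𝒥 : Finset (Fin p)) (D : Matrix 𝒥 τ ℝ) (i : Fin p)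
    (j : τ) : (selection 𝒥 * D) i j = if h : i ∈ 𝒥 then D ⟨i, h⟩ j else 0 := by
  rw [Matrix.mul_apply]
  split_ifs with h
  · rw [Finset.sum_eq_single ⟨i, h⟩]
    · have : selection 𝒥 i ⟨i, h⟩ = 1 := Matrix.one_apply_eq i
      rw [this, one_mul]
    · intro q _ hq
      have : ¬ (i = q.1) := fun h' => hq (Subtype.ext h'.symm)
      simp [selection, colsOf, this]
    · simp
  · refine Finset.sum_eq_zero fun q _ => ?_
    have : ¬ (i = q.1) := fun h' => h (h' ▸ q.2)
    simp [selection, colsOf, this]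

lemma selection_mul_rowsOf {p m : ℕ} (B : Matrix (Fin p) (Fin m) ℝ) :
    selection (rowSupport B) * rowsOf B (rowSupport B) = B := by
  ext i j
  rw [selection_mul_apply]
  split_ifs with h
  · rfl
  · have : B i = 0 := by simpa [rowSupport] using h
    rw [this]; rfl

lemma exists_eq_mul_of_forall_col {α β τ : Type*} [Fintype β] (A : Matrix α β ℝ)
    (B : Matrix α τ ℝ) (h : ∀ j, ∃ x, A *ᵥ x = fun i => B i j) : ∃ D : Matrix β τ ℝ, B = A * D := by
  choose x hx using h
  refine ⟨Matrix.of fun b j => x j b, ?_⟩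
  ext i j
  exact (congrFun (hx j) i).symm

section Pattern

variable {p m : ℕ} {ι κ : Type*} [Fintype ι] [DecidableEq ι] [Fintype κ] [DecidableEq κ]

lemma IsPattern.transpose_mul_self {B : Matrix (Fin p) (Fin m) ℝ} {O : Matrix (Fin p) ι ℝ}
    (h : IsPattern B O) : Oᵀ * O = 1 := by
  cases h with
  | projection hr U horth hspan hO =>
    rw [hO, Matrix.transpose_mul, Matrix.mul_assoc, ← Matrix.mul_assoc _ _ U,
      selection_transpose_mul, Matrix.one_mul, horth]
  | selection hr e hO =>
    have : Oᵀ * O = ((SCV.selection (rowSupport B))ᵀ * SCV.selection (rowSupport B)).submatrix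
        e e := by
      rw [hO, Matrix.transpose_submatrix, ← Matrix.submatrix_mul _ _ _ id _ Function.bijective_id]
    rw [this, selection_transpose_mul, Matrix.submatrix_one_equiv]

/-- The columns of `U` span those of the nonzero rows of `B`, and the selection matrix restores the
zero rows. -/
lemma IsPattern.exists_eq_mul {B : Matrix (Fin p) (Fin m) ℝ} {O : Matrix (Fin p) ι ℝ}
    (h : IsPattern B O) : ∃ D : Matrix ι (Fin m) ℝ, B = O * D := by
  cases h with
  | projection hr U horth hspan hO =>
    obtain ⟨D, hD⟩ := exists_eq_mul_of_forall_col U (rowsOf B (rowSupport B)) fun j => by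
      have : (rowsOf B (rowSupport B)).mulVecLin (Pi.single j 1) ∈
          LinearMap.range U.mulVecLin := by rw [hspan]; exact LinearMap.mem_range_self _ _
      obtain ⟨x, hx⟩ := this
      refine ⟨x, ?_⟩
      rw [Matrix.mulVecLin_apply, Matrix.mulVecLin_apply] at hx
      rw [hx]
      ext i; simp
    refine ⟨D, ?_⟩
    rw [hO, Matrix.mul_assoc, ← hD, selection_mul_rowsOf]
  | selection hr e hO =>
    refine ⟨(rowsOf B (rowSupport B)).submatrix e id, ?_⟩
    rw [hO, Matrix.submatrix_mul_equiv, selection_mul_rowsOf, Matrix.submatrix_id_id]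

lemma rank_eq_card_of_transpose_mul_self {O : Matrix (Fin p) ι ℝ} (hO : Oᵀ * O = 1) :
    O.rank = Fintype.card ι := by
  rw [← Matrix.rank_transpose_mul_self, hO, Matrix.rank_one]

lemma posDef_transpose_mul_mul {Sigma : Matrix (Fin p) (Fin p) ℝ} (hS : Sigma.PosDef)
    {O : Matrix (Fin p) ι ℝ} (hO : Oᵀ * O = 1) : (Oᵀ * Sigma * O).PosDef := by
  have hinj : Function.Injective O.mulVec := fun x y hxy => by
    have := congrArg (Oᵀ *ᵥ ·) hxy
    simpa [Matrix.mulVec_mulVec, hO] using this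
  simpa using hS.conjTranspose_mul_mul_same hinj

lemma toEuclideanCLM_projMatrix_mulVec (W : Submodule ℝ (EuclideanSpace ℝ (Fin p)))
    (b : Fin p → ℝ) :
    WithLp.toLp 2 (projMatrix W *ᵥ b) = W.starProjection (WithLp.toLp 2 b) := by
  have : Matrix.toEuclideanCLM (n := Fin p) (𝕜 := ℝ) (projMatrix W) = W.starProjection :=
    StarAlgEquiv.apply_symm_apply _ _
  rw [← this]
  rfl

lemma mem_colSpace_iff {O : Matrix (Fin p) ι ℝ} {b : Fin p → ℝ} :
    WithLp.toLp 2 b ∈ colSpace O ↔ ∃ x, O *ᵥ x = b := by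
  constructor
  · rintro ⟨x, hx⟩
    exact ⟨WithLp.ofLp x, (WithLp.toLp_injective 2) hx⟩
  · rintro ⟨x, rfl⟩
    exact ⟨WithLp.toLp 2 x, rfl⟩

/-- Within `W`, projecting onto the complement of `W ⊓ U` removes exactly the projection onto `W ⊓
U`. The difference is therefore that projection, which lies in `U`. -/
lemma sub_starProjection_mem {V : Type*} [NormedAddCommGroup V] [InnerProductSpace ℝ V]
    [FiniteDimensional ℝ V] (W U : Submodule ℝ V) {b : V} (hb : b ∈ W) :
    b - (W ⊓ (W ⊓ U)ᗮ).starProjection b ∈ U := by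
  have h1 := (W ⊓ U).starProjection_apply_mem b
  have h2 : b - (W ⊓ U).starProjection b ∈ (W ⊓ U)ᗮ := (W ⊓ U).sub_starProjection_mem_orthogonal b
  have h3 : (W ⊓ (W ⊓ U)ᗮ).starProjection b = b - (W ⊓ U).starProjection b := by
    refine Submodule.eq_starProjection_of_mem_orthogonal
      ⟨W.sub_mem hb h1.1, h2⟩ ?_
    rw [sub_sub_cancel]
    exact Submodule.orthogonal_le inf_le_right ((W ⊓ U).le_orthogonal_orthogonal h1)
  rw [h3, sub_sub_cancel]
  exact h1.2

/-- The columns of `B*` lie in the column space of `Ostar`, so `B* - P° B*` has its columns in that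
of `O`. This supplies the decomposition assumed by `cv_identity`, with `G = P° B*`. -/
lemma exists_eq_mul_add_projCirc {Bstar : Matrix (Fin p) (Fin m) ℝ} (O : Matrix (Fin p) ι ℝ)
    {Ostar : Matrix (Fin p) κ ℝ} (h : IsPattern Bstar Ostar) :
    ∃ C : Matrix ι (Fin m) ℝ, Bstar = O * C + projCirc O Ostar * Bstar := by
  obtain ⟨D, hD⟩ := h.exists_eq_mul
  obtain ⟨C, hC⟩ := exists_eq_mul_of_forall_col O (Bstar - projCirc O Ostar * Bstar) fun j => by
    rw [← mem_colSpace_iff]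
    have hb : WithLp.toLp 2 (fun i => Bstar i j) ∈ colSpace Ostar := by
      rw [mem_colSpace_iff]
      exact ⟨fun a => D a j, by ext i; exact (congrFun (congrFun hD i) j).symm⟩
    have := sub_starProjection_mem (colSpace Ostar) (colSpace O) hb
    rw [← toEuclideanCLM_projMatrix_mulVec] at this
    exact this
  exact ⟨C, by rw [← hC]; abel⟩

end Pattern

/-! ### Variable selection -/

section VariableSelection

variable {n p K : ℕ}

/-- The part of a coefficient vector outside `𝒥`, as a one-column matrix. -/
def offSupport (βstar : Fin p → ℝ) (𝒥 : Finset (Fin p)) : Matrix (Fin p) (Fin 1) ℝ :=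
  Matrix.of fun i _ => if i ∈ 𝒥 then 0 else βstar i

lemma replicateCol_eq_selection_mul_add (βstar : Fin p → ℝ) (𝒥 : Finset (Fin p)) :
    Matrix.replicateCol (Fin 1) βstar =
      selection 𝒥 * (Matrix.of fun (q : 𝒥) _ => βstar q) + offSupport βstar 𝒥 := by
  ext i j
  rw [Matrix.add_apply, selection_mul_apply]
  by_cases h : i ∈ 𝒥 <;> simp [h, offSupport]

lemma response_eq {ν : Type*} (X : Matrix ν (Fin p) ℝ) (βstar : Fin p → ℝ) (ε : ν → ℝ)
    (𝒥 : Finset (Fin p)) :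
    response X βstar ε = X * (selection 𝒥 * (Matrix.of fun (q : 𝒥) _ => βstar q) +
      offSupport βstar 𝒥) + Matrix.replicateCol (Fin 1) ε := by
  rw [← replicateCol_eq_selection_mul_add]
  rfl

/-- Indices outside the support of `β*` contribute nothing, so summing over the missed support or
over all of `𝒥ᶜ` gives the same signal. -/
lemma replicateCol_missed {ν : Type*} (X : Matrix ν (Fin p) ℝ) (βstar : Fin p → ℝ)
    (𝒥 : Finset (Fin p)) :
    Matrix.replicateCol (Fin 1) (missed X βstar 𝒥) = X * offSupport βstar 𝒥 := by
  ext i j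
  rw [Matrix.mul_apply]
  have h : missed X βstar 𝒥 i = ∑ q ∈ supp βstar ∩ 𝒥ᶜ, X i q * βstar q :=
    Finset.sum_coe_sort (supp βstar ∩ 𝒥ᶜ) fun q => X i q * βstar q
  rw [Matrix.replicateCol_apply, h]
  refine (Finset.sum_congr rfl fun q hq => ?_).trans
    (Finset.sum_subset (Finset.subset_univ (supp βstar ∩ 𝒥ᶜ)) fun q _ hq => ?_)
  · have : q ∉ 𝒥 := by simpa using (Finset.mem_inter.1 hq).2
    simp [offSupport, this]
  · by_cases hJ : q ∈ 𝒥
    · simp [offSupport, hJ]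
    · have : βstar q = 0 := by
        by_contra h0
        exact hq (by simp [supp, hJ, h0])
      simp [offSupport, this]

lemma replicateCol_olsVec {ν ι : Type*} [Fintype ν] [Fintype ι] [DecidableEq ι]
    (Z : Matrix ν ι ℝ) (y : ν → ℝ) :
    Matrix.replicateCol (Fin 1) (olsVec Z y) = ols Z (Matrix.replicateCol (Fin 1) y) := rfl

lemma replicateCol_betaTrain (fold : Fin n → Fin K) (k : Fin K) (βstar : Fin p → ℝ)
    (𝒥 : Finset (Fin p)) (X : Matrix (Fin n) (Fin p) ℝ) :
    Matrix.replicateCol (Fin 1) (betaTrain fold k βstar 𝒥 X) =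
      ols (trainPart fold k X * selection 𝒥) (trainPart fold k X * offSupport βstar 𝒥) := by
  rw [betaTrain, replicateCol_olsVec, colsOf_eq_mul_selection, replicateCol_missed]

lemma replicateCol_betaFull (βstar : Fin p → ℝ) (𝒥 : Finset (Fin p))
    (X : Matrix (Fin n) (Fin p) ℝ) :
    Matrix.replicateCol (Fin 1) (betaFull βstar 𝒥 X) =
      ols (X * selection 𝒥) (X * offSupport βstar 𝒥) := by
  rw [betaFull, replicateCol_olsVec, colsOf_eq_mul_selection, replicateCol_missed]

lemma sqNorm_mulVec_sub {α β : Type*} [Fintype α] [Fintype β] (A : Matrix α β ℝ) (u v : β → ℝ) :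
    sqNorm (A *ᵥ (u - v)) =
      frobSq (A * (Matrix.replicateCol (Fin 1) u - Matrix.replicateCol (Fin 1) v)) := by
  have : A * (Matrix.replicateCol (Fin 1) u - Matrix.replicateCol (Fin 1) v) =
      Matrix.replicateCol (Fin 1) (A *ᵥ (u - v)) := rfl
  rw [this]
  simp [sqNorm, frobSq]

lemma replicateCol_integral_betaTrain {Ω : Type*} [MeasurableSpace Ω] (μ : Measure Ω)
    (X : Ω → Matrix (Fin n) (Fin p) ℝ) (fold : Fin n → Fin K) (k : Fin K) (βstar : Fin p → ℝ)
    (𝒥 : Finset (Fin p)) :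
    Matrix.replicateCol (Fin 1) (fun j => ∫ ω, betaTrain fold k βstar 𝒥 (X ω) j ∂μ) =
      expect μ fun ω => ols (trainPart fold k (X ω) * selection 𝒥)
        (trainPart fold k (X ω) * offSupport βstar 𝒥) := by
  ext i j
  simp only [← replicateCol_betaTrain]
  rfl

lemma smul_submatrix_eq (Sigma : Matrix (Fin p) (Fin p) ℝ) (𝒥 : Finset (Fin p)) (c : ℝ) :
    c • Sigma.submatrix (Subtype.val : 𝒥 → Fin p) Subtype.val =
      (selection 𝒥)ᵀ * (c • Sigma) * selection 𝒥 := by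
  rw [selection_transpose_mul_apply, ← colsOf_eq_mul_selection]
  rfl

end VariableSelection

end SCV

theorem corollary1
    {Ω : Type*} [MeasurableSpace Ω] (μ : Measure Ω) [IsProbabilityMeasure μ]
    (n p d K : ℕ)
    (fold : Fin n → Fin K)
    (hfold : ∀ k, Fintype.card {i // fold i = k} = d)
    (Sigma : Matrix (Fin p) (Fin p) ℝ) (hSigma : Sigma.PosDef) (σ : ℝ)
    (X : Ω → Matrix (Fin n) (Fin p) ℝ) :
    -- the joint sparse and low-rank model
    (∀ (m : ℕ) (E : Ω → Matrix (Fin n) (Fin m) ℝ),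
      SCV.GaussianModel μ Sigma σ X E →
      ∀ (Bstar B : Matrix (Fin p) (Fin m) ℝ)
        (ι κ : Type) [Fintype ι] [DecidableEq ι] [Fintype κ] [DecidableEq κ]
        (O : Matrix (Fin p) ι ℝ) (Ostar : Matrix (Fin p) κ ℝ),
        SCV.IsPattern B O → SCV.IsPattern Bstar Ostar →
        d + O.rank + 1 < n →
        ∀ k : Fin K,
          Integrable (fun ω => SCV.cvErr fold (X ω) (X ω * Bstar + E ω) O) μ ∧
          Integrable (fun ω => SCV.trnErr (X ω) (X ω * Bstar + E ω) O) μ ∧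
          (∀ i j, Integrable
            (fun ω => SCV.coefTrain fold k Bstar O Ostar (X ω) i j) μ) ∧
          Integrable (SCV.underfitFull μ X fold k Bstar O Ostar) μ ∧
          Integrable (SCV.underfitTrain μ Sigma X fold k Bstar O Ostar) μ ∧
          ∫ ω, SCV.cvErr fold (X ω) (X ω * Bstar + E ω) O ∂μ =
            ∫ ω, (SCV.trnErr (X ω) (X ω * Bstar + E ω) O +
              ((2 - ((O.rank : ℝ) + 1) / n) * K - 1) /
                ((1 - ((O.rank : ℝ) + 1) / n) * K - 1) * (m * O.rank * σ ^ 2)) ∂μ +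
            SCV.underfit μ Sigma X fold k Bstar O Ostar) ∧
    -- ordinary variable selection with a single response
    (∀ (ε : Ω → Fin n → ℝ),
      SCV.GaussianModel μ Sigma σ X (fun ω => Matrix.replicateCol (Fin 1) (ε ω)) →
      ∀ (βstar : Fin p → ℝ) (𝒥 : Finset (Fin p)),
        d + 𝒥.card + 1 < n →
        ∀ k : Fin K,
          Integrable (fun ω =>
            SCV.cvErr fold (X ω) (SCV.response (X ω) βstar (ε ω)) (SCV.selection 𝒥)) μ ∧
          Integrable (fun ω =>
            SCV.trnErr (X ω) (SCV.response (X ω) βstar (ε ω)) (SCV.selection 𝒥)) μ ∧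
          (∀ j, Integrable (fun ω => SCV.betaTrain fold k βstar 𝒥 (X ω) j) μ) ∧
          Integrable (SCV.selUnderfitFull μ X fold k βstar 𝒥) μ ∧
          Integrable (SCV.selUnderfitTrain μ Sigma X fold k βstar 𝒥) μ ∧
          ∫ ω, SCV.cvErr fold (X ω) (SCV.response (X ω) βstar (ε ω)) (SCV.selection 𝒥) ∂μ =
            ∫ ω, SCV.trnErr (X ω) (SCV.response (X ω) βstar (ε ω)) (SCV.selection 𝒥) ∂μ +
            ((2 - ((𝒥.card : ℝ) + 1) / n) * K - 1) /
              ((1 - ((𝒥.card : ℝ) + 1) / n) * K - 1) * (𝒥.card * σ ^ 2) +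
            ∫ ω, SCV.selUnderfitFull μ X fold k βstar 𝒥 ω ∂μ +
            ∫ ω, SCV.selUnderfitTrain μ Sigma X fold k βstar 𝒥 ω ∂μ) := by
  constructor
  · intro m E hM Bstar B ι κ _ _ _ _ O Ostar hB hBstar hd k
    have hO := hB.transpose_mul_self
    -- Orthonormal columns make the rank of `O` the number of its columns, which is the count
    -- entering the Wishart expectation.
    have hr := SCV.rank_eq_card_of_transpose_mul_self hO
    obtain ⟨C, hC⟩ := SCV.exists_eq_mul_add_projCirc O hBstar
    rw [hr] at hd ⊢
    obtain ⟨h1, h2, h3, h4, h5, h6⟩ := SCV.cv_identity hfold hSigma hM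
      (SCV.posDef_transpose_mul_mul hSigma hO) C (SCV.projCirc O Ostar * Bstar) hd k
    rw [← hC] at h1 h2 h6
    simp only [← Matrix.mul_assoc] at h3 h4 h5 h6
    refine ⟨h1, h2, h3, h4, h5, ?_⟩
    rw [integral_add h2 (integrable_const _), integral_const, probReal_univ, one_smul, h6]
    exact add_assoc _ _ _
  · intro ε hM βstar 𝒥 hd k
    have hO := SCV.selection_transpose_mul 𝒥
    have hcard : Fintype.card 𝒥 = 𝒥.card := Fintype.card_coe 𝒥
    obtain ⟨h1, h2, h3, h4, h5, h6⟩ := SCV.cv_identity hfold hSigma hM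
      (SCV.posDef_transpose_mul_mul hSigma hO) (Matrix.of fun (q : 𝒥) _ => βstar q)
      (SCV.offSupport βstar 𝒥) (by rw [hcard]; exact hd) k
    -- With vectors read as one-column matrices, both underfitting terms become those of
    -- `cv_identity` for `O = selection 𝒥` and `G = offSupport βstar 𝒥`.
    have e1 : SCV.selUnderfitFull μ X fold k βstar 𝒥 = _ := funext fun ω => by
      rw [SCV.selUnderfitFull, SCV.sqNorm_mulVec_sub, SCV.replicateCol_integral_betaTrain,
        SCV.replicateCol_betaFull, SCV.colsOf_eq_mul_selection]
    have e2 : SCV.selUnderfitTrain μ Sigma X fold k βstar 𝒥 = _ := funext fun ω => by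
      rw [SCV.selUnderfitTrain, SCV.sqNorm_mulVec_sub, SCV.replicateCol_integral_betaTrain,
        SCV.replicateCol_betaTrain, SCV.smul_submatrix_eq]
    simp only [← SCV.response_eq] at h1 h2 h6
    refine ⟨h1, h2, fun j => ?_, e1 ▸ h4, e2 ▸ h5, ?_⟩
    · have := h3 j 0
      simp only [← SCV.replicateCol_betaTrain] at this
      exact this
    · rw [e1, e2, h6, hcard]
      simp
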